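/- Let $m\ge 2$ be an even integer, let $\mathbb{S}^{m-1}=\{x\in\mathbb{R}^m:\|x\|=1\}$ carry its Euclidean surface measure $dS$, and for $\omega\in\mathbb{S}^{m-1}$ let $\mathbb{S}_{0,\omega}=\{x\in\mathbb{S}^{m-1}:\langle x,\omega\rangle=0\}$ carry its $(m-2)$-dimensional Euclidean surface measure (the counting measure if $m=2$), of total mass $\sigma_{m-1}=2\pi^{(m-1)/2}/\Gamma(\frac{m-1}{2})$. For $f:\mathbb{S}^{m-1}\to\mathbb{C}$ define the codimension-one spherical Radon (Funk) transform and, for $\phi:\mathbb{S}^{m-1}\to\mathbb{C}$, the dual transform by $$\widehat f(\omega)=\int_{\mathbb{S}_{0,\omega}}f(x)\,dS_x,\qquad \check\phi(x)=\frac1{\sigma_{m-1}}\int_{\mathbb{S}_{0,x}}\phi(\omega)\,dS_\omega .$$ Let $\Delta_{LB}=\|x\|^2\Delta_x-(m-2+\mathbb{E})\mathbb{E}$, with $\Delta_x=\sum_{j}\partial_{x_j}^2$ and $\mathbb{E}=\sum_{j}x_j\partial_{x_j}$, be the Laplace-Beltrami operator of $\mathbb{S}^{m-1}$, and let $$P_{m-2}(z)=\prod_{j=1}^{(m-2)/2}\bigl[z-(m-2j-1)(2j-1)\bigr].$$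 Then the Radon transform is inverted on even functions by $$2(-4\pi)^{\frac{m-2}{2}}\,\frac{\Gamma(\frac{m-1}{2})}{\Gamma(\frac12)}\;f=P_{m-2}(\Delta_{LB})\,(\widehat f\,)^{\vee}.$$ More precisely: (a) If $f\in L^2(\mathbb{S}^{m-1})$ is even (almost everywhere), then $\widehat f$ and $(\widehat f\,)^\vee$ are defined by convergent integrals almost everywhere, both belong to $L^2(\mathbb{S}^{m-1})$, and the formula holds in the sense of distributions on $\mathbb{S}^{m-1}$, i.e. for every $\varphi\in C^\infty(\mathbb{S}^{m-1};\mathbb{C})$ $$\int_{\mathbb{S}^{m-1}}(\widehat f\,)^\vee\,P_{m-2}(\Delta_{LB})\varphi\,dS=2(-4\pi)^{\frac{m-2}{2}}\,\frac{\Gamma(\frac{m-1}{2})}{\Gamma(\frac12)}\int_{\mathbb{S}^{m-1}}f\,\varphi\,dS.$$ (b) If $f\in C^\infty(\mathbb{S}^{m-1};\mathbb{C})$ is even, then $\widehat f$ and $(\widehat f\,)^\vee$ are smooth and the formula holds at every point of $\mathbb{S}^{m-1}$. -/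

import Mathlib

open MeasureTheory Metric
open scoped Manifold ContDiff Polynomial

namespace FunkTransform

noncomputable section

/-- The unit sphere of `ℝ^m`. -/
abbrev USphere (m : ℕ) : Type := sphere (0 : EuclideanSpace ℝ (Fin m)) 1

/-- The surface measure of the unit sphere of `ℝ^m`. -/
def surfaceMeasure (m : ℕ) : Measure (USphere m) :=
  (volume : Measure (EuclideanSpace ℝ (Fin m))).toSphere

/-- The hyperplane through the origin that is orthogonal to the unit vector `w`. -/
abbrev hyperplane {m : ℕ} (w : USphere m) : Submodule ℝ (EuclideanSpace ℝ (Fin m)) :=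
  (Submodule.span ℝ {(w : EuclideanSpace ℝ (Fin m))})ᗮ

/-- The inclusion of the unit sphere of the hyperplane orthogonal to `w`, that is, of the geodesic
sub-sphere `{x : ‖x‖ = 1, ⟪x, w⟫ = 0}`, into the unit sphere. -/
def subsphereIncl {m : ℕ} (w : USphere m) (y : sphere (0 : hyperplane w) 1) : USphere m :=
  ⟨((y : hyperplane w) : EuclideanSpace ℝ (Fin m)), by
    rw [mem_sphere_zero_iff_norm]
    exact norm_eq_of_mem_sphere y⟩

/-- The Euclidean surface measure of the geodesic sub-sphere orthogonal to `w`, as a measure on the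
unit sphere. For `m = 2` it is the counting measure of a pair of antipodal points. -/
def subsphereMeasure {m : ℕ} (w : USphere m) : Measure (USphere m) :=
  ((volume : Measure (hyperplane w)).toSphere).map (subsphereIncl w)

/-- The surface area `2 π ^ (n / 2) / Γ (n / 2)` of the unit sphere of `ℝ^n`. -/
def sphereArea (n : ℕ) : ℝ :=
  2 * Real.pi ^ ((n : ℝ) / 2) / Real.Gamma ((n : ℝ) / 2)

/-- The codimension-one spherical Radon (Funk) transform; the geodesic sub-sphere orthogonal to `w`
is labelled by `w` (and also by `-w`). -/
def radon {m : ℕ} (f : USphere m → ℂ) (w : USphere m) : ℂ :=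
  ∫ x, f x ∂(subsphereMeasure w)

/-- The dual transform: the average of `φ` over the geodesic sub-spheres through `x`, which are the
ones orthogonal to the unit vectors `w` with `⟪w, x⟫ = 0`. -/
def dualRadon {m : ℕ} (φ : USphere m → ℂ) (x : USphere m) : ℂ :=
  ((sphereArea (m - 1) : ℝ) : ℂ)⁻¹ * ∫ w, φ w ∂(subsphereMeasure x)

instance finrankFact (m : ℕ) [NeZero m] :
    Fact (Module.finrank ℝ (EuclideanSpace ℝ (Fin m)) = (m - 1) + 1) :=
  ⟨by
    have := NeZero.pos m
    rw [finrank_euclideanSpace_fin]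
    omega⟩

/-- Smooth complex-valued functions on the unit sphere of `ℝ^m`, a manifold of dimension `m - 1`. -/
def Smooth {m : ℕ} [NeZero m] (f : USphere m → ℂ) : Prop :=
  ContMDiff (𝓡 (m - 1)) 𝓘(ℝ, ℂ) ∞ f

/-- The extension of a function on the sphere that is constant on open rays from the origin. -/
def radialExt {m : ℕ} (g : USphere m → ℂ) (y : EuclideanSpace ℝ (Fin m)) : ℂ :=
  open Classical in
  if h : y = 0 then 0
  else g ⟨‖y‖⁻¹ • y, by simp [norm_smul, norm_ne_zero_iff.mpr h]⟩

/-- The Euler operator `∑ j, x_j ∂/∂x_j`. -/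
def euler {m : ℕ} (G : EuclideanSpace ℝ (Fin m) → ℂ) (y : EuclideanSpace ℝ (Fin m)) : ℂ :=
  fderiv ℝ G y y

/-- The operator `‖x‖² Δ - (m - 2 + 𝔼) 𝔼`, where `𝔼` is the Euler operator, on functions of
`m` real variables. -/
def ambientLB {m : ℕ} (G : EuclideanSpace ℝ (Fin m) → ℂ) (y : EuclideanSpace ℝ (Fin m)) : ℂ :=
  ((‖y‖ ^ 2 : ℝ) : ℂ) * Laplacian.laplacian G y
    - (((m : ℂ) - 2) * euler G y + euler (euler G) y)

/-- The Laplace-Beltrami operator of the unit sphere: `ambientLB` is tangential to the sphere, so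
it may be evaluated on any smooth extension, for which the radial one is taken. -/
def laplaceBeltrami {m : ℕ} (g : USphere m → ℂ) (x : USphere m) : ℂ :=
  ambientLB (radialExt g) (x : EuclideanSpace ℝ (Fin m))

/-- `P(Δ_LB) g = ∑ i, a_i Δ_LB^i g` for a polynomial `P = ∑ i, a_i z^i`. -/
def polyLB {m : ℕ} (P : ℝ[X]) (g : USphere m → ℂ) (x : USphere m) : ℂ :=
  P.sum fun i a => (a : ℂ) * (laplaceBeltrami^[i] g) x

/-- `P(Δ_LB) u = v` on the sphere in the sense of distributions. (As `Δ_LB` is symmetric and `P`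
is real, `P(Δ_LB)` is its own transpose.) -/
def WeakPolyLB {m : ℕ} [NeZero m] (P : ℝ[X]) (u v : USphere m → ℂ) : Prop :=
  ∀ φ : USphere m → ℂ, Smooth φ →
    ∫ x, u x * polyLB P φ x ∂(surfaceMeasure m) = ∫ x, v x * φ x ∂(surfaceMeasure m)

/-- The polynomial `∏_{j=1}^{(m-2)/2} (z - (m - 2j - 1)(2j - 1))`. -/
def helgasonPoly (m : ℕ) : ℝ[X] :=
  ∏ j ∈ Finset.Icc 1 ((m - 2) / 2),
    (Polynomial.X - Polynomial.C (((m : ℝ) - 2 * (j : ℝ) - 1) * (2 * (j : ℝ) - 1)))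

/-- The constant `2 (-4π)^{(m-2)/2} Γ((m-1)/2) / Γ(1/2)`. -/
def helgasonConst (m : ℕ) : ℝ :=
  2 * (-4 * Real.pi) ^ ((m - 2) / 2) * (Real.Gamma (((m : ℝ) - 1) / 2) / Real.Gamma (1 / 2))

end

end FunkTransform

open FunkTransform

/-!
The dual transform is a multiple of the Radon transform `R` itself, so the assertion concerns
`P(Δ) R²`, where `P` is `helgasonPoly m`. Both operators are symmetric, and both act explicitly on
the even zonal polynomials `x ↦ q (⟪x, y⟫ ^ 2)` with a fixed axis `y`. The identity is proved on
these functions and transferred to all others by testing against them.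

*Symmetry.* `R` is the integral operator attached to a measure on pairs of orthogonal unit vectors,
and averaging over the orthogonal group shows that this measure is invariant under the exchange of
the two vectors (`flagMeasure_map_swap`), because a reflection exchanges them. Hence `R` is bounded
and symmetric on `L²` (`memLp_radon`, `integral_radon_mul`). The symmetry of `Δ` is Green's formula
(`integral_sphere_mul_laplacian`), obtained by integrating by parts in a shell around the sphere.

*Zonal polynomials.* In the variable `s = ⟪x, y⟫ ^ 2` the operators `Δ` and `R` become
endomorphisms of `ℝ[X]`: a second order differential operator of hypergeometric type
(`laplaceBeltrami_zonal`), and the map that sends `s ^ k` to a multiple of `(1 - s) ^ k`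
(`radon_zonal`), the factor being a moment of the sphere of dimension `m - 2`. The two
endomorphisms commute and are triangular in the monomial basis, and `Δ` has distinct diagonal
entries. A triangular operator that commutes with `Δ` and has constant diagonal is therefore a
scalar, and for `P(Δ) R²` the diagonal is constant by a computation with these moments
(`helgasonPoly_eval_mul_sphereMoment_sq`). This is where `m` has to be even: the denominators of the
moments then cancel against their numerators up to finitely many factors, and these make up `P`.

*Conclusion.* A continuous even function that is orthogonal to all even zonal polynomials vanishes,
by the Weierstrass theorem (`eq_zero_of_integral_mul_zonal`). This gives the formula for smooth even
functions (`polyLB_radon_radon`), and, with the operators in the opposite order,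
`R² P(Δ) φ = c φ` up to the odd part of `φ` (`radon_radon_polyLB`). Since `R` is symmetric on `L²`,
the second formula is the weak form of the inversion formula.
-/

namespace FunkTransform

/-! ### Isometries and surface measures -/

section Isometry

variable {V W : Type*} [NormedAddCommGroup V] [InnerProductSpace ℝ V]
  [NormedAddCommGroup W] [InnerProductSpace ℝ W]

/-- The map of unit spheres induced by a linear isometry equivalence. -/
def sphereMap (e : V ≃ₗᵢ[ℝ] W) (x : sphere (0 : V) 1) : sphere (0 : W) 1 :=
  ⟨e x, by rw [mem_sphere_zero_iff_norm, e.norm_map]; exact norm_eq_of_mem_sphere x⟩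

@[simp]
lemma sphereMap_coe (e : V ≃ₗᵢ[ℝ] W) (x : sphere (0 : V) 1) : (sphereMap e x : W) = e x := rfl

lemma continuous_sphereMap (e : V ≃ₗᵢ[ℝ] W) : Continuous (sphereMap e) :=
  (e.continuous.comp continuous_subtype_val).subtype_mk _

/-- Surface measures are preserved by linear isometries. -/
lemma toSphere_map_sphereMap [FiniteDimensional ℝ V] [FiniteDimensional ℝ W]
    [MeasurableSpace V] [BorelSpace V] [MeasurableSpace W] [BorelSpace W] (e : V ≃ₗᵢ[ℝ] W) :
    (volume : Measure V).toSphere.map (sphereMap e) = (volume : Measure W).toSphere := by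
  ext s hs
  have hm : Measurable (sphereMap e) := (continuous_sphereMap e).measurable
  rw [Measure.map_apply hm hs, Measure.toSphere_apply' _ (hm hs), Measure.toSphere_apply' _ hs,
    e.toLinearEquiv.finrank_eq]
  congr 1
  rw [← (e.measurePreserving).measure_preimage_equiv (f := e.toMeasurableEquiv)]
  congr 1
  ext v
  simp only [Set.mem_smul, Set.mem_image, Set.mem_preimage]
  constructor
  · rintro ⟨r, hr, _, ⟨x, hx, rfl⟩, rfl⟩
    exact ⟨r, hr, _, ⟨_, hx, rfl⟩, by simp⟩
  · rintro ⟨r, hr, _, ⟨x, hx, rfl⟩, h⟩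
    refine ⟨r, hr, _, ⟨sphereMap e.symm x, ?_, rfl⟩, ?_⟩
    · convert! hx
      ext
      simp
    · apply e.injective
      simpa using h

lemma reflection_orthogonal_singleton_apply (u x : V) :
    (Submodule.span ℝ {u})ᗮ.reflection x = x - (2 * (inner ℝ u x / ‖u‖ ^ 2)) • u := by
  rw [Submodule.reflection_orthogonal_apply, Submodule.reflection_singleton_apply]
  simp [mul_smul, two_smul]

end Isometry

/-! ### The family of geodesic sub-spheres -/

section Subsphere

variable {m : ℕ}

lemma surfaceMeasure_map_sphereMap
    (e : EuclideanSpace ℝ (Fin m) ≃ₗᵢ[ℝ] EuclideanSpace ℝ (Fin m)) :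
    (surfaceMeasure m).map (sphereMap e) = surfaceMeasure m :=
  toSphere_map_sphereMap e

instance : IsFiniteMeasure (surfaceMeasure m) :=
  inferInstanceAs (IsFiniteMeasure (volume : Measure (EuclideanSpace ℝ (Fin m))).toSphere)

lemma continuous_subsphereIncl (w : USphere m) : Continuous (subsphereIncl w) :=
  (continuous_subtype_val.comp continuous_subtype_val).subtype_mk _

instance (w : USphere m) : IsFiniteMeasure (subsphereMeasure w) :=
  inferInstanceAs (IsFiniteMeasure (Measure.map _ _))

lemma hyperplane_sphereMap (e : EuclideanSpace ℝ (Fin m) ≃ₗᵢ[ℝ] EuclideanSpace ℝ (Fin m))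
    (w : USphere m) :
    (hyperplane w).map (e.toLinearEquiv : EuclideanSpace ℝ (Fin m) →ₗ[ℝ] _) =
      hyperplane (sphereMap e w) := by
  ext v
  simp only [Submodule.mem_map, hyperplane, Submodule.mem_orthogonal_singleton_iff_inner_right]
  constructor
  · rintro ⟨x, hx, rfl⟩
    simpa using hx
  · intro h
    refine ⟨e.symm v, ?_, by simp⟩
    rw [← e.inner_map_map]
    simpa using h

lemma subsphereMeasure_map_sphereMap
    (e : EuclideanSpace ℝ (Fin m) ≃ₗᵢ[ℝ] EuclideanSpace ℝ (Fin m)) (w : USphere m) :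
    (subsphereMeasure w).map (sphereMap e) = subsphereMeasure (sphereMap e w) := by
  let e' : hyperplane w ≃ₗᵢ[ℝ] hyperplane (sphereMap e w) :=
    (e.submoduleMap (hyperplane w)).trans (LinearIsometryEquiv.ofEq _ _ (hyperplane_sphereMap e w))
  rw [subsphereMeasure, subsphereMeasure, ← toSphere_map_sphereMap e',
    Measure.map_map (continuous_sphereMap e).measurable (continuous_subsphereIncl w).measurable,
    Measure.map_map (continuous_subsphereIncl _).measurable (continuous_sphereMap e').measurable]
  rfl

lemma hyperplane_neg (w : USphere m) : hyperplane (-w) = hyperplane w := by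
  simp [hyperplane, ← Set.neg_singleton]

lemma subsphereMeasure_neg (w : USphere m) : subsphereMeasure (-w) = subsphereMeasure w := by
  let e' : hyperplane (-w) ≃ₗᵢ[ℝ] hyperplane w := LinearIsometryEquiv.ofEq _ _ (hyperplane_neg w)
  rw [subsphereMeasure, subsphereMeasure, ← toSphere_map_sphereMap e',
    Measure.map_map (continuous_subsphereIncl _).measurable (continuous_sphereMap e').measurable]
  rfl

/-- The reflection that carries `w₀` to `-w`, which serves as well as `w` since the orthogonal
sub-spheres agree. It is the identity if `w = -w₀`. -/
noncomputable def swapReflection (w₀ w : USphere m) :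
    EuclideanSpace ℝ (Fin m) ≃ₗᵢ[ℝ] EuclideanSpace ℝ (Fin m) :=
  (Submodule.span ℝ {(w + w₀ : EuclideanSpace ℝ (Fin m))})ᗮ.reflection

lemma swapReflection_apply (w₀ w : USphere m) (x : EuclideanSpace ℝ (Fin m)) :
    swapReflection w₀ w x = x - (2 * (inner ℝ (w + w₀ : EuclideanSpace ℝ (Fin m)) x /
      ‖(w + w₀ : EuclideanSpace ℝ (Fin m))‖ ^ 2)) • (w + w₀ : EuclideanSpace ℝ (Fin m)) :=
  reflection_orthogonal_singleton_apply _ _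

lemma swapReflection_self (w₀ w : USphere m) :
    sphereMap (swapReflection w₀ w) w₀ = -w := by
  ext1
  have := Submodule.reflection_sub (v := (w₀ : EuclideanSpace ℝ (Fin m)))
    (w := -(w : EuclideanSpace ℝ (Fin m))) (by simp)
  rw [sub_neg_eq_add, add_comm] at this
  simpa [swapReflection] using this

/-- All sub-sphere measures are images of one of them under a reflection that depends measurably,
and away from one point smoothly, on the parameter. -/
lemma subsphereMeasure_eq_map (w₀ w : USphere m) :
    subsphereMeasure w = (subsphereMeasure w₀).map (sphereMap (swapReflection w₀ w)) := by
  rw [subsphereMeasure_map_sphereMap, swapReflection_self, subsphereMeasure_neg]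

lemma measurable_swapReflection (w₀ : USphere m) :
    Measurable fun p : USphere m × USphere m => sphereMap (swapReflection w₀ p.1) p.2 := by
  refine Measurable.subtype_mk ?_
  simp only [swapReflection_apply]
  fun_prop

lemma measurable_subsphereMeasure : Measurable (subsphereMeasure (m := m)) := by
  rcases isEmpty_or_nonempty (USphere m) with h | ⟨⟨w₀⟩⟩
  · exact measurable_of_empty _
  refine Measure.measurable_of_measurable_coe _ fun s hs => ?_
  have : ∀ w, subsphereMeasure w s =
      subsphereMeasure w₀ (Prod.mk w ⁻¹'
        ((fun p : USphere m × USphere m => sphereMap (swapReflection w₀ p.1) p.2) ⁻¹' s)) := by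
    intro w
    rw [subsphereMeasure_eq_map w₀ w, Measure.map_apply (continuous_sphereMap _).measurable hs]
    rfl
  simp only [this]
  exact measurable_measure_prodMk_left (measurable_swapReflection w₀ hs)

/-- The family of measures `w ↦ subsphereMeasure w`, as a kernel. -/
noncomputable def subsphereKernel (m : ℕ) : ProbabilityTheory.Kernel (USphere m) (USphere m) where
  toFun := subsphereMeasure
  measurable' := measurable_subsphereMeasure

lemma subsphereKernel_apply (w : USphere m) : subsphereKernel m w = subsphereMeasure w := rfl

lemma subsphereMeasure_univ_eq (w w₀ : USphere m) :
    subsphereMeasure w Set.univ = subsphereMeasure w₀ Set.univ := by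
  rw [subsphereMeasure_eq_map w₀ w, Measure.map_apply (continuous_sphereMap _).measurable .univ,
    Set.preimage_univ]

instance : ProbabilityTheory.IsFiniteKernel (subsphereKernel m) := by
  rcases isEmpty_or_nonempty (USphere m) with h | ⟨⟨w₀⟩⟩
  · exact ⟨0, by simp, fun w => h.elim w⟩
  · exact ⟨subsphereMeasure w₀ Set.univ, measure_lt_top _ _, fun w =>
      (subsphereMeasure_univ_eq w w₀).le⟩

end Subsphere

/-! ### Symmetry of the Radon transform -/

section Flag

variable {m : ℕ}

/-- The measure on the set of pairs of orthogonal unit vectors whose disintegration over the first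
factor is `w ↦ subsphereMeasure w`. -/
noncomputable def flagMeasure (m : ℕ) : Measure (USphere m × USphere m) :=
  (surfaceMeasure m).compProd (subsphereKernel m)

instance : IsFiniteMeasure (flagMeasure m) :=
  inferInstanceAs (IsFiniteMeasure ((surfaceMeasure m).compProd (subsphereKernel m)))

lemma lintegral_flagMeasure {F : USphere m × USphere m → ENNReal} (hF : Measurable F) :
    ∫⁻ p, F p ∂(flagMeasure m) =
      ∫⁻ w, ∫⁻ x, F (w, x) ∂(subsphereMeasure w) ∂(surfaceMeasure m) := by
  rw [flagMeasure, Measure.lintegral_compProd hF]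
  rfl

/-- The flag measure is invariant under the orthogonal group. -/
lemma lintegral_flagMeasure_sphereMap
    (e : EuclideanSpace ℝ (Fin m) ≃ₗᵢ[ℝ] EuclideanSpace ℝ (Fin m))
    {F : USphere m × USphere m → ENNReal} (hF : Measurable F) :
    ∫⁻ p, F (sphereMap e p.1, sphereMap e p.2) ∂(flagMeasure m) = ∫⁻ p, F p ∂(flagMeasure m) := by
  have he : Measurable (sphereMap e) := (continuous_sphereMap e).measurable
  have hI : Measurable fun w => ∫⁻ x, F (w, x) ∂(subsphereMeasure w) :=
    Measurable.lintegral_kernel_prod_right' (κ := subsphereKernel m) hF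
  rw [lintegral_flagMeasure hF, lintegral_flagMeasure (by fun_prop)]
  conv_rhs => rw [← surfaceMeasure_map_sphereMap e, lintegral_map hI he]
  refine lintegral_congr fun w => ?_
  rw [← subsphereMeasure_map_sphereMap, lintegral_map (by fun_prop) he]

/-- The orthogonal group of `ℝ^m`, as the unitary group of the algebra of endomorphisms. It is
compact in the operator norm topology. -/
abbrev OrthGroup (m : ℕ) : Type :=
  unitary (EuclideanSpace ℝ (Fin m) →L[ℝ] EuclideanSpace ℝ (Fin m))

instance : ContinuousStar (EuclideanSpace ℝ (Fin m) →L[ℝ] EuclideanSpace ℝ (Fin m)) :=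
  ⟨(ContinuousLinearMap.adjoint (𝕜 := ℝ) (E := EuclideanSpace ℝ (Fin m))
    (F := EuclideanSpace ℝ (Fin m))).continuous⟩

instance : CompactSpace (OrthGroup m) := by
  refine isCompact_iff_compactSpace.1 ?_
  refine Metric.isCompact_of_isClosed_isBounded isClosed_unitary ?_
  refine (Metric.isBounded_closedBall (x := 0) (r := 1)).subset fun u hu => ?_
  rw [mem_closedBall_zero_iff]
  exact ContinuousLinearMap.opNorm_le_bound _ zero_le_one fun x => by
    rw [one_mul]
    exact (Unitary.norm_map ⟨u, hu⟩ x).le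

noncomputable instance : MeasurableSpace (OrthGroup m) := borel _
instance : BorelSpace (OrthGroup m) := ⟨rfl⟩

/-- The action of an orthogonal transformation on the unit sphere. -/
noncomputable def orthAct (u : OrthGroup m) : USphere m → USphere m :=
  sphereMap (Unitary.linearIsometryEquiv u)

lemma orthAct_coe (u : OrthGroup m) (x : USphere m) :
    (orthAct u x : EuclideanSpace ℝ (Fin m)) =
      (u : EuclideanSpace ℝ (Fin m) →L[ℝ] EuclideanSpace ℝ (Fin m)) x := rfl

lemma continuous_orthAct :
    Continuous fun p : OrthGroup m × USphere m => orthAct p.1 p.2 := by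
  refine Continuous.subtype_mk (f := fun p : OrthGroup m × USphere m =>
    (p.1 : EuclideanSpace ℝ (Fin m) →L[ℝ] EuclideanSpace ℝ (Fin m)) p.2) ?_ _
  fun_prop

/-- The average over the orthogonal group of `F (u⁻¹ w, u⁻¹ x)`. -/
noncomputable def orthAverage (F : USphere m × USphere m → ENNReal) (p : USphere m × USphere m) :
    ENNReal :=
  ∫⁻ u : OrthGroup m, F (orthAct u⁻¹ p.1, orthAct u⁻¹ p.2) ∂Measure.haar

lemma orthAverage_orthAct (F : USphere m × USphere m → ENNReal) (w x : USphere m)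
    (v : OrthGroup m) :
    orthAverage F (orthAct v w, orthAct v x) = orthAverage F (w, x) := by
  unfold orthAverage
  rw [← lintegral_mul_left_eq_self _ v]
  refine lintegral_congr fun u => ?_
  have : ∀ z : USphere m, orthAct (v * u)⁻¹ (orthAct v z) = orthAct u⁻¹ z := by
    intro z
    ext1
    rw [orthAct_coe, orthAct_coe, orthAct_coe, ← mul_apply_eq_comp,
      ← Submonoid.coe_mul]
    simp
  simp only [this]

/-- Averages over the orthogonal group are symmetric, since the reflection in the direction of
`w - x` exchanges the unit vectors `w` and `x`. -/
lemma orthAverage_swap (F : USphere m × USphere m → ENNReal) (w x : USphere m) :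
    orthAverage F (w, x) = orthAverage F (x, w) := by
  let r : EuclideanSpace ℝ (Fin m) ≃ₗᵢ[ℝ] EuclideanSpace ℝ (Fin m) :=
    (Submodule.span ℝ {(w - x : EuclideanSpace ℝ (Fin m))})ᗮ.reflection
  have hw : orthAct (Unitary.linearIsometryEquiv.symm r) w = x := by
    ext1
    rw [orthAct_coe, Unitary.coe_symm_linearIsometryEquiv_apply]
    exact Submodule.reflection_sub (by simp)
  have hx : orthAct (Unitary.linearIsometryEquiv.symm r) x = w := by
    ext1
    rw [orthAct_coe, Unitary.coe_symm_linearIsometryEquiv_apply, ← hw, orthAct_coe,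
      Unitary.coe_symm_linearIsometryEquiv_apply]
    exact Submodule.reflection_reflection _ _
  rw [← orthAverage_orthAct F w x (Unitary.linearIsometryEquiv.symm r), hw, hx]

/-- Averaging over the orthogonal group does not change integrals, up to the mass of the group. -/
lemma lintegral_orthAverage {F : USphere m × USphere m → ENNReal} (hF : Measurable F) :
    ∫⁻ p, orthAverage F p ∂(flagMeasure m) =
      Measure.haar (Set.univ : Set (OrthGroup m)) * ∫⁻ p, F p ∂(flagMeasure m) := by
  unfold orthAverage
  rw [lintegral_lintegral_swap]
  · rw [mul_comm, ← lintegral_const]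
    refine lintegral_congr fun u => ?_
    exact lintegral_flagMeasure_sphereMap (Unitary.linearIsometryEquiv u⁻¹) hF
  · refine (hF.comp (Measurable.prodMk ?_ ?_)).aemeasurable
    · exact (continuous_orthAct.comp
        (continuous_snd.inv.prodMk continuous_fst.fst)).measurable
    · exact (continuous_orthAct.comp
        (continuous_snd.inv.prodMk continuous_fst.snd)).measurable

/-- The flag measure is symmetric: averaging over the orthogonal group reduces this to the fact
that two unit vectors are exchanged by a reflection. -/
lemma flagMeasure_map_swap : (flagMeasure m).map Prod.swap = flagMeasure m := by
  refine Measure.ext_of_lintegral _ fun F hF => ?_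
  rw [lintegral_map hF measurable_swap]
  have h0 : Measure.haar (Set.univ : Set (OrthGroup m)) ≠ 0 :=
    isOpen_univ.measure_ne_zero _ Set.univ_nonempty
  have h1 : Measure.haar (Set.univ : Set (OrthGroup m)) ≠ ⊤ := measure_ne_top _ _
  rw [← ENNReal.mul_right_inj h0 h1, ← lintegral_orthAverage hF,
    ← lintegral_orthAverage (F := fun p => F p.swap) (by fun_prop)]
  exact lintegral_congr fun p => orthAverage_swap F p.2 p.1

lemma sphereArea_nonneg (n : ℕ) : 0 ≤ sphereArea n :=
  div_nonneg (by positivity) (Real.Gamma_nonneg_of_nonneg (by positivity))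

lemma toSphere_univ {V : Type*} [NormedAddCommGroup V] [InnerProductSpace ℝ V]
    [FiniteDimensional ℝ V] [MeasurableSpace V] [BorelSpace V] :
    (volume : Measure V).toSphere Set.univ =
      ENNReal.ofReal (sphereArea (Module.finrank ℝ V)) := by
  rw [Measure.toSphere_apply_univ]
  rcases Nat.eq_zero_or_pos (Module.finrank ℝ V) with h | h
  · simp [h, sphereArea]
  have : Nontrivial V := Module.finrank_pos_iff.1 h
  have h' : (Module.finrank ℝ V : ℝ) / 2 ≠ 0 := by positivity
  rw [InnerProductSpace.volume_ball, ← ENNReal.ofReal_natCast, ENNReal.ofReal_one, one_pow,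
    one_mul, ← ENNReal.ofReal_mul (by positivity), sphereArea, Real.Gamma_add_one h',
    Real.sqrt_eq_rpow, ← Real.rpow_mul_natCast Real.pi_pos.le, one_div_mul_eq_div]
  congr 1
  have := (Real.Gamma_pos_of_pos (by positivity : 0 < (Module.finrank ℝ V : ℝ) / 2)).ne'
  field_simp

lemma finrank_hyperplane (w : USphere m) : Module.finrank ℝ (hyperplane w) = m - 1 := by
  have h := Submodule.finrank_add_finrank_orthogonal
    (Submodule.span ℝ {(w : EuclideanSpace ℝ (Fin m))})
  rw [finrank_span_singleton (ne_zero_of_mem_unit_sphere w), finrank_euclideanSpace_fin] at h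
  change 1 + Module.finrank ℝ (hyperplane w) = m at h
  omega

/-- The total mass of the geodesic sub-spheres. -/
lemma subsphereMeasure_univ (w : USphere m) :
    subsphereMeasure w Set.univ = ENNReal.ofReal (sphereArea (m - 1)) := by
  rw [subsphereMeasure, Measure.map_apply (continuous_subsphereIncl w).measurable .univ,
    Set.preimage_univ, toSphere_univ, finrank_hyperplane]

lemma flagMeasure_map_fst :
    (flagMeasure m).map Prod.fst = ENNReal.ofReal (sphereArea (m - 1)) • surfaceMeasure m := by
  refine Measure.ext_of_lintegral _ fun F hF => ?_
  rw [lintegral_map hF measurable_fst, lintegral_flagMeasure (by fun_prop), lintegral_smul_measure,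
    smul_eq_mul, ← lintegral_const_mul _ hF]
  refine lintegral_congr fun w => ?_
  simp [subsphereMeasure_univ, mul_comm]

lemma flagMeasure_map_snd :
    (flagMeasure m).map Prod.snd = ENNReal.ofReal (sphereArea (m - 1)) • surfaceMeasure m := by
  rw [← flagMeasure_map_fst]
  conv_rhs => rw [← flagMeasure_map_swap, Measure.map_map measurable_fst measurable_swap]
  rfl

lemma memLp_comp_fst_flagMeasure {f : USphere m → ℂ} {p : ENNReal}
    (hf : MemLp f p (surfaceMeasure m)) : MemLp (fun q => f q.1) p (flagMeasure m) := by
  have h : MemLp f p ((flagMeasure m).map Prod.fst) := by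
    rw [flagMeasure_map_fst]
    exact hf.smul_measure ENNReal.ofReal_ne_top
  exact h.comp_of_map measurable_fst.aemeasurable

lemma memLp_comp_snd_flagMeasure {f : USphere m → ℂ} {p : ENNReal}
    (hf : MemLp f p (surfaceMeasure m)) : MemLp (fun q => f q.2) p (flagMeasure m) := by
  have h : MemLp f p ((flagMeasure m).map Prod.snd) := by
    rw [flagMeasure_map_snd]
    exact hf.smul_measure ENNReal.ofReal_ne_top
  exact h.comp_of_map measurable_snd.aemeasurable

lemma ae_integrable_subsphereMeasure {f : USphere m → ℂ} (hf : Integrable f (surfaceMeasure m)) :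
    ∀ᵐ w ∂(surfaceMeasure m), Integrable f (subsphereMeasure w) := by
  have h := (memLp_comp_snd_flagMeasure (memLp_one_iff_integrable.2 hf)).integrable le_rfl
  exact ((Measure.integrable_compProd_iff h.aestronglyMeasurable).1 h).1

/-- The Radon transform maps `L²` to `L²`, by the Cauchy-Schwarz inequality on each sub-sphere. -/
lemma memLp_radon {f : USphere m → ℂ} (hf : MemLp f 2 (surfaceMeasure m)) :
    MemLp (radon f) 2 (surfaceMeasure m) := by
  have h2 := memLp_comp_snd_flagMeasure hf
  have hmeas : AEStronglyMeasurable (radon f) (surfaceMeasure m) :=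
    (h2.aestronglyMeasurable.integral_kernel_compProd : AEStronglyMeasurable
      (fun w => ∫ x, f x ∂(subsphereKernel m w)) (surfaceMeasure m))
  rw [memLp_two_iff_integrable_sq_norm hmeas]
  have hsq := (memLp_two_iff_integrable_sq_norm h2.aestronglyMeasurable).1 h2
  obtain ⟨hae, hint⟩ := (Measure.integrable_compProd_iff hsq.aestronglyMeasurable).1 hsq
  simp only [norm_pow, norm_norm, subsphereKernel_apply] at hint hae
  refine (hint.const_mul (sphereArea (m - 1))).mono' (hmeas.norm.pow 2) ?_
  filter_upwards [hae, ae_integrable_subsphereMeasure (hf.integrable one_le_two)] with w hw2 hw1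
  rw [Real.norm_of_nonneg (by positivity)]
  have hσ : (subsphereMeasure w).real Set.univ = sphereArea (m - 1) := by
    rw [measureReal_def, subsphereMeasure_univ, ENNReal.toReal_ofReal (sphereArea_nonneg _)]
  -- The integral of `(‖f‖ - c) ^ 2` is a non-negative quadratic polynomial in `c`.
  have hquad : ∀ c : ℝ, 0 ≤ sphereArea (m - 1) * (c * c) +
      (-2 * ∫ x, ‖f x‖ ∂(subsphereMeasure w)) * c + ∫ x, ‖f x‖ ^ 2 ∂(subsphereMeasure w) := by
    intro c
    have h : 0 ≤ ∫ x, (‖f x‖ - c) ^ 2 ∂(subsphereMeasure w) := integral_nonneg fun x => sq_nonneg _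
    have e : ∀ x, (‖f x‖ - c) ^ 2 = ‖f x‖ ^ 2 + ((-2 * c) * ‖f x‖ + c * c) := fun x => by ring
    simp only [e] at h
    have hw3 : Integrable (fun x => (-2 * c) * ‖f x‖) (subsphereMeasure w) := hw1.norm.const_mul _
    have hw4 : Integrable (fun x => (-2 * c) * ‖f x‖ + c * c) (subsphereMeasure w) :=
      hw3.add (integrable_const _)
    rw [integral_add hw2 hw4,
      integral_add hw3 (integrable_const _), integral_const_mul, integral_const,
      hσ, smul_eq_mul] at h
    linarith
  have hd := discrim_le_zero hquad
  have hn : ‖radon f w‖ ≤ ∫ x, ‖f x‖ ∂(subsphereMeasure w) := norm_integral_le_integral_norm _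
  have := pow_le_pow_left₀ (norm_nonneg _) hn 2
  rw [discrim] at hd
  linarith

/-- The Radon transform is symmetric. -/
lemma integral_radon_mul {f h : USphere m → ℂ} (hf : MemLp f 2 (surfaceMeasure m))
    (hh : MemLp h 2 (surfaceMeasure m)) :
    ∫ w, radon f w * h w ∂(surfaceMeasure m) = ∫ x, f x * radon h x ∂(surfaceMeasure m) := by
  have key : ∀ f h : USphere m → ℂ, MemLp f 2 (surfaceMeasure m) → MemLp h 2 (surfaceMeasure m) →
      ∫ q, h q.1 * f q.2 ∂(flagMeasure m) = ∫ w, h w * radon f w ∂(surfaceMeasure m) := by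
    intro f h hf hh
    have hi : Integrable (fun q : USphere m × USphere m => h q.1 * f q.2) (flagMeasure m) :=
      MemLp.integrable_mul (𝕜 := ℂ) (memLp_comp_fst_flagMeasure hh) (memLp_comp_snd_flagMeasure hf)
    rw [flagMeasure, Measure.integral_compProd hi]
    refine integral_congr_ae (.of_forall fun w => ?_)
    exact integral_const_mul (h w) f
  rw [← key h f hh hf, ← flagMeasure_map_swap]
  rw [show Prod.swap = MeasurableEquiv.prodComm (α := USphere m) (β := USphere m) from rfl,
    (MeasurableEquiv.prodComm (α := USphere m) (β := USphere m)).measurableEmbedding.integral_map]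
  have := key f h hf hh
  simp only [mul_comm (h _)] at this
  exact this.symm

end Flag

/-! ### Smoothness of parametric integrals -/

section ParametricIntegral

/-- The integrand of a parametric integral over a compact space is bounded, uniformly for parameters
near a given one. -/
lemma exists_bound_of_compact {E V X G : Type*} [NormedAddCommGroup E] [NormedSpace ℝ E]
    [FiniteDimensional ℝ E] [TopologicalSpace V] [TopologicalSpace X] [CompactSpace X]
    [NormedAddCommGroup G] {U : Set E} {Ω : Set (E × V)} {φ : X → V} {f : E × V → G}
    (hU : IsOpen U) (hφ : Continuous φ) (hUΩ : ∀ w ∈ U, ∀ x, (w, φ x) ∈ Ω)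
    (hf : ContinuousOn f Ω) {w₀ : E} (hw₀ : w₀ ∈ U) :
    ∃ s ∈ nhds w₀, s ⊆ U ∧ ∃ C : ℝ, ∀ w ∈ s, ∀ x, ‖f (w, φ x)‖ ≤ C := by
  have : ProperSpace E := FiniteDimensional.proper ℝ E
  obtain ⟨ε, hε, hεU⟩ := Metric.nhds_basis_closedBall.mem_iff.1 (hU.mem_nhds hw₀)
  have hK : IsCompact (closedBall w₀ ε ×ˢ (Set.univ : Set X)) :=
    (isCompact_closedBall w₀ ε).prod isCompact_univ
  have hc : ContinuousOn (fun p : E × X => f (p.1, φ p.2)) (closedBall w₀ ε ×ˢ Set.univ) :=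
    hf.comp (by fun_prop) fun p hp => hUΩ _ (hεU hp.1) _
  obtain ⟨C, hC⟩ := hK.exists_bound_of_continuousOn hc
  exact ⟨_, closedBall_mem_nhds w₀ hε, hεU, C, fun w hw x => hC (w, x) ⟨hw, trivial⟩⟩

variable {E V X : Type} [NormedAddCommGroup E] [NormedSpace ℝ E] [FiniteDimensional ℝ E]
  [NormedAddCommGroup V] [NormedSpace ℝ V]
  [TopologicalSpace X] [CompactSpace X] [MeasurableSpace X] [OpensMeasurableSpace X]
  [SecondCountableTopology X]
  {U : Set E} {Ω : Set (E × V)} {φ : X → V}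

/-- Differentiation under an integral over a compact space preserves smoothness. -/
lemma contDiffOn_integral_nat (μ : Measure X) [IsFiniteMeasure μ] (hU : IsOpen U) (hΩ : IsOpen Ω)
    (hφ : Continuous φ) (hUΩ : ∀ w ∈ U, ∀ x, (w, φ x) ∈ Ω) (n : ℕ) :
    ∀ {G : Type} [NormedAddCommGroup G] [NormedSpace ℝ G] {f : E × V → G},
      ContDiffOn ℝ n f Ω → ContDiffOn ℝ n (fun w => ∫ x, f (w, φ x) ∂μ) U := by
  have hslice : ∀ {G : Type} [NormedAddCommGroup G] {f : E × V → G}, ContinuousOn f Ω →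
      ∀ {w : E}, w ∈ U → Continuous fun x => f (w, φ x) := fun hf w hw =>
    hf.comp_continuous (by fun_prop) fun x => hUΩ w hw x
  induction n with
  | zero =>
    intro G _ _ f hf
    have hf := hf.continuousOn
    refine contDiffOn_zero.2 fun w₀ hw₀ => ContinuousAt.continuousWithinAt ?_
    obtain ⟨s, hs, hsU, C, hC⟩ := exists_bound_of_compact hU hφ hUΩ hf hw₀
    refine continuousAt_of_dominated (bound := fun _ => C) ?_ ?_ (integrable_const C) ?_
    · filter_upwards [hs] with w hw
      exact (hslice hf (hsU hw)).aestronglyMeasurable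
    · filter_upwards [hs] with w hw
      exact .of_forall (hC w hw)
    · refine .of_forall fun x => ?_
      exact (hf.continuousAt (hΩ.mem_nhds (hUΩ _ hw₀ x))).comp (f := fun w => (w, φ x))
        (by fun_prop)
  | succ n ih =>
    intro G _ _ f hf
    let f' : E × V → E →L[ℝ] G := fun p => (fderiv ℝ f p).comp (ContinuousLinearMap.inl ℝ E V)
    have hf' : ContDiffOn ℝ n f' Ω := by
      have := ((contDiffOn_succ_iff_fderiv_of_isOpen (n := (n : ℕ∞ω)) hΩ).1
        (by exact_mod_cast hf)).2.2
      exact this.clm_comp contDiffOn_const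
    have hd : ∀ p ∈ Ω, HasFDerivAt (fun w => f (w, p.2)) (f' p) p.1 := by
      intro p hp
      have h1 : HasFDerivAt f (fderiv ℝ f p) (p.1, p.2) :=
        ((hf.differentiableOn (by simp)).differentiableAt (hΩ.mem_nhds hp)).hasFDerivAt
      exact h1.comp p.1 (hasFDerivAt_prodMk_left p.1 p.2)
    have key : ∀ w₀ ∈ U, HasFDerivAt (fun w => ∫ x, f (w, φ x) ∂μ)
        (∫ x, f' (w₀, φ x) ∂μ) w₀ := by
      intro w₀ hw₀
      obtain ⟨s, hs, hsU, C, hC⟩ := exists_bound_of_compact hU hφ hUΩ hf'.continuousOn hw₀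
      refine hasFDerivAt_integral_of_dominated_of_fderiv_le (bound := fun _ => C)
        (F' := fun w x => f' (w, φ x)) hs ?_ ?_ ?_ ?_ (integrable_const C) ?_
      · filter_upwards [hs] with w hw
        exact (hslice hf.continuousOn (hsU hw)).aestronglyMeasurable
      · exact (hslice hf.continuousOn hw₀).integrable_of_hasCompactSupport
          (HasCompactSupport.of_compactSpace _)
      · exact (hslice hf'.continuousOn hw₀).aestronglyMeasurable
      · exact .of_forall fun x w hw => hC w hw x
      · exact .of_forall fun x w hw => hd (w, φ x) (hUΩ w (hsU hw) x)
    have := (contDiffOn_succ_iff_hasFDerivWithinAt_of_uniqueDiffOn (𝕜 := ℝ) (n := (n : ℕ∞ω))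
      (f := fun w => ∫ x, f (w, φ x) ∂μ) hU.uniqueDiffOn).2
      ⟨by simp, _, ih hf', fun w hw => (key w hw).hasFDerivWithinAt⟩
    exact_mod_cast this

lemma contDiffOn_integral (μ : Measure X) [IsFiniteMeasure μ] (hU : IsOpen U) (hΩ : IsOpen Ω)
    (hφ : Continuous φ) (hUΩ : ∀ w ∈ U, ∀ x, (w, φ x) ∈ Ω)
    {G : Type} [NormedAddCommGroup G] [NormedSpace ℝ G] {f : E × V → G}
    (hf : ContDiffOn ℝ ∞ f Ω) : ContDiffOn ℝ ∞ (fun w => ∫ x, f (w, φ x) ∂μ) U :=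
  contDiffOn_infty.2 fun n => contDiffOn_integral_nat μ hU hΩ hφ hUΩ n (contDiffOn_infty.1 hf n)

end ParametricIntegral

/-! ### The Laplacian and radially constant functions -/

section Laplacian

variable {V : Type*} [NormedAddCommGroup V] [InnerProductSpace ℝ V] [FiniteDimensional ℝ V]

lemma laplacian_eq_sum {ι : Type*} [Fintype ι] (b : OrthonormalBasis ι ℝ V) (F : V → ℂ) (y : V) :
    Laplacian.laplacian F y = ∑ i, fderiv ℝ (fderiv ℝ F) y (b i) (b i) := by
  rw [InnerProductSpace.laplacian_eq_iteratedFDeriv_orthonormalBasis F b]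
  simp [iteratedFDeriv_two_apply]

lemma contDiffOn_laplacian {F : V → ℂ} {U : Set V} (hU : IsOpen U) (hF : ContDiffOn ℝ ∞ F U) :
    ContDiffOn ℝ ∞ (Laplacian.laplacian F) U := by
  have h2 := ((contDiffOn_infty_iff_fderiv_of_isOpen hU).1
    ((contDiffOn_infty_iff_fderiv_of_isOpen hU).1 hF).2).2
  rw [show Laplacian.laplacian F = _ from funext (laplacian_eq_sum (stdOrthonormalBasis ℝ V) F)]
  exact ContDiffOn.sum fun i _ => (h2.clm_apply contDiffOn_const).clm_apply contDiffOn_const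

end Laplacian

section SmoothRadial

variable {V : Type*} [NormedAddCommGroup V] [InnerProductSpace ℝ V]

/-- A complex function on a real vector space that is smooth away from the origin and constant on
open rays from the origin. -/
structure SmoothRadial (F : V → ℂ) : Prop where
  contDiffOn : ContDiffOn ℝ ∞ F {0}ᶜ
  smul : ∀ r : ℝ, 0 < r → ∀ y, F (r • y) = F y

namespace SmoothRadial

variable {F G : V → ℂ}

lemma contDiffAt (hF : SmoothRadial F) {y : V} (hy : y ≠ 0) : ContDiffAt ℝ ∞ F y :=
  hF.contDiffOn.contDiffAt (isOpen_compl_singleton.mem_nhds hy)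

lemma hasFDerivAt (hF : SmoothRadial F) {y : V} (hy : y ≠ 0) :
    HasFDerivAt F (fderiv ℝ F y) y :=
  ((hF.contDiffAt hy).differentiableAt (by simp)).hasFDerivAt

lemma contDiffOn_fderiv (hF : SmoothRadial F) : ContDiffOn ℝ ∞ (fderiv ℝ F) {0}ᶜ :=
  ((contDiffOn_infty_iff_fderiv_of_isOpen isOpen_compl_singleton).1 hF.contDiffOn).2

lemma hasFDerivAt_fderiv (hF : SmoothRadial F) {y : V} (hy : y ≠ 0) :
    HasFDerivAt (fderiv ℝ F) (fderiv ℝ (fderiv ℝ F) y) y :=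
  ((hF.contDiffOn_fderiv.contDiffAt (isOpen_compl_singleton.mem_nhds hy)).differentiableAt
    (by simp)).hasFDerivAt

lemma const (c : ℂ) : SmoothRadial fun _ : V => c := ⟨contDiffOn_const, fun _ _ _ => rfl⟩

/-- The Euler operator annihilates functions that are homogeneous of degree zero. -/
lemma fderiv_self (hF : SmoothRadial F) (y : V) : fderiv ℝ F y y = 0 := by
  by_cases hy : y = 0
  · simp [hy]
  have h1 : HasFDerivAt F (fderiv ℝ F y) ((1 : ℝ) • y) := by
    rw [one_smul]
    exact hF.hasFDerivAt hy
  have h2 : HasDerivAt (fun r : ℝ => r • y) y 1 := by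
    simpa using (hasDerivAt_id (1 : ℝ)).smul_const y
  refine (h1.comp_hasDerivAt (1 : ℝ) h2).unique
    ((hasDerivAt_const (1 : ℝ) (F y)).congr_of_eventuallyEq ?_)
  filter_upwards [lt_mem_nhds one_pos] with r hr
  exact hF.smul r hr y

/-- The Laplacian of a function of degree zero is homogeneous of degree `-2`. -/
lemma laplacian_smul [FiniteDimensional ℝ V] (hF : SmoothRadial F) {r : ℝ} (hr : 0 < r) (y : V) :
    Laplacian.laplacian F (r • y) = ((r ^ 2)⁻¹ : ℝ) * Laplacian.laplacian F y := by
  have h1 : fderiv ℝ F = fun y => r • fderiv ℝ F (r • y) := by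
    funext y
    rw [← fderiv_comp_smul]
    congr 1
    exact funext fun z => (hF.smul r hr z).symm
  have h2 : fderiv ℝ (fderiv ℝ F) y = r • r • fderiv ℝ (fderiv ℝ F) (r • y) := by
    conv_lhs => rw [h1]
    have : Invertible r := invertibleOfNonzero hr.ne'
    rw [← fderiv_comp_smul]
    exact fderiv_const_smul_of_invertible (f := fun y => fderiv ℝ F (r • y)) r
  simp only [laplacian_eq_sum (stdOrthonormalBasis ℝ V), h2, Finset.mul_sum]
  refine Finset.sum_congr rfl fun i _ => ?_
  have : (r : ℂ) ≠ 0 := Complex.ofReal_ne_zero.2 hr.ne'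
  simp only [smul_apply, Complex.real_smul]
  push_cast
  field_simp

end SmoothRadial

end SmoothRadial

/-! ### Smooth functions on the sphere -/

section RadialExt

variable {m : ℕ}

lemma radialExt_of_ne_zero (g : USphere m → ℂ) {y : EuclideanSpace ℝ (Fin m)} (h : y ≠ 0) :
    radialExt g y = g ⟨‖y‖⁻¹ • y, by simp [norm_smul, norm_ne_zero_iff.mpr h]⟩ := by
  simp [radialExt, h]

@[simp]
lemma radialExt_coe (g : USphere m → ℂ) (x : USphere m) :
    radialExt g (x : EuclideanSpace ℝ (Fin m)) = g x := by
  rw [radialExt_of_ne_zero g (ne_zero_of_mem_unit_sphere x)]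
  congr 1
  ext1
  simp

lemma radialExt_smul (g : USphere m → ℂ) {r : ℝ} (hr : 0 < r) (y : EuclideanSpace ℝ (Fin m)) :
    radialExt g (r • y) = radialExt g y := by
  by_cases h : y = 0
  · simp [h]
  rw [radialExt_of_ne_zero g h, radialExt_of_ne_zero g (by simp [h, hr.ne'])]
  congr 2
  rw [norm_smul, Real.norm_of_nonneg hr.le, smul_smul]
  congr 1
  field_simp

lemma contDiffAt_radialExt [NeZero m] {f : USphere m → ℂ} (hf : Smooth f)
    {y : EuclideanSpace ℝ (Fin m)} (hy : y ≠ 0) : ContDiffAt ℝ ∞ (radialExt f) y := by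
  -- `h` agrees with the identity near `y` and does not vanish, so that it can be normalised.
  let b : ContDiffBump y := ⟨‖y‖ / 4, ‖y‖ / 2, by positivity, by linarith [norm_pos_iff.2 hy]⟩
  let h : EuclideanSpace ℝ (Fin m) → EuclideanSpace ℝ (Fin m) := fun x => y + b x • (x - y)
  have hsm : ContDiff ℝ ∞ h := contDiff_const.add (b.contDiff.smul (contDiff_id.sub contDiff_const))
  have hne : ∀ x, h x ≠ 0 := by
    intro x hx
    have h1 : ‖b x • (x - y)‖ = ‖y‖ := by
      rw [← norm_neg y, ← eq_neg_of_add_eq_zero_right hx]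
    have h2 : ‖b x • (x - y)‖ ≤ ‖y‖ / 2 := by
      by_cases hxb : x ∈ ball y (‖y‖ / 2)
      · rw [norm_smul, Real.norm_of_nonneg b.nonneg]
        rw [mem_ball, dist_eq_norm] at hxb
        exact (mul_le_of_le_one_left (norm_nonneg _) b.le_one).trans hxb.le
      · have : b x = 0 := b.zero_of_le_dist (by simpa using hxb)
        rw [this, zero_smul, norm_zero]
        positivity
    linarith [norm_pos_iff.2 hy]
  have hn : ContDiff ℝ ∞ fun x => ‖h x‖⁻¹ • h x :=
    ((hsm.norm ℝ hne).inv fun x => norm_ne_zero_iff.2 (hne x)).smul hsm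
  have hs : ∀ x, ‖h x‖⁻¹ • h x ∈ sphere (0 : EuclideanSpace ℝ (Fin m)) 1 := fun x => by
    simp [norm_smul, norm_ne_zero_iff.mpr (hne x)]
  have hcomp : ContDiff ℝ ∞ fun x => f (Set.codRestrict _ _ hs x) :=
    (hf.comp (hn.contMDiff.codRestrict_sphere hs)).contDiff
  refine hcomp.contDiffAt.congr_of_eventuallyEq ?_
  filter_upwards [b.eventuallyEq_one, isOpen_ne.mem_nhds hy] with x hx hx0
  have hxe : h x = x := by simp [h, hx]
  rw [radialExt_of_ne_zero f hx0]
  congr 1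
  ext1
  simp [hxe]

/-- A function on the sphere with a smooth extension to a neighbourhood of the sphere is smooth. -/
lemma smooth_of_contDiffOn [NeZero m] {f : USphere m → ℂ} {F : EuclideanSpace ℝ (Fin m) → ℂ}
    (hF : ∀ x : USphere m, ContDiffAt ℝ ∞ F x) (h : ∀ x : USphere m, F x = f x) : Smooth f := by
  have : f = fun x : USphere m => F x := funext fun x => (h x).symm
  rw [this]
  intro x
  exact (hF x).contMDiffAt.comp x (contMDiff_coe_sphere x)

lemma Smooth.continuous [NeZero m] {f : USphere m → ℂ} (hf : Smooth f) : Continuous f :=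
  ContMDiff.continuous hf

lemma Smooth.smoothRadial [NeZero m] {f : USphere m → ℂ} (hf : Smooth f) :
    SmoothRadial (radialExt f) :=
  ⟨fun _ hy => (contDiffAt_radialExt hf hy).contDiffWithinAt,
    fun _ hr y => radialExt_smul f hr y⟩

/-- Near `w₀` the Radon transform is an integral over the fixed sub-sphere orthogonal to `w₀`, with
a smooth dependence on the parameter. -/
lemma Smooth.radon [NeZero m] {f : USphere m → ℂ} (hf : Smooth f) : Smooth (radon f) := by
  intro w₀
  -- `T (w, x)` is the image of `x` under the reflection that carries `w₀` to `-w`, if `w` is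
  -- a unit vector.
  let u : EuclideanSpace ℝ (Fin m) × EuclideanSpace ℝ (Fin m) → EuclideanSpace ℝ (Fin m) :=
    fun p => p.1 + w₀
  let T : EuclideanSpace ℝ (Fin m) × EuclideanSpace ℝ (Fin m) → EuclideanSpace ℝ (Fin m) :=
    fun p => p.2 - (2 * (inner ℝ (u p) p.2 / ‖u p‖ ^ 2)) • u p
  let U : Set (EuclideanSpace ℝ (Fin m)) := {w | w + w₀ ≠ 0}
  let Ω : Set (EuclideanSpace ℝ (Fin m) × EuclideanSpace ℝ (Fin m)) := {p | u p ≠ 0 ∧ p.2 ≠ 0}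
  have hu : ContDiff ℝ ∞ u := contDiff_fst.add contDiff_const
  have hT : ContDiffOn ℝ ∞ T Ω := by
    have hc : ContDiffOn ℝ ∞ (fun p => 2 * (inner ℝ (u p) p.2 / ‖u p‖ ^ 2)) Ω :=
      contDiffOn_const.mul ((hu.inner ℝ contDiff_snd).contDiffOn.div (hu.norm_sq ℝ).contDiffOn
        fun p hp => by simpa using hp.1)
    exact contDiff_snd.contDiffOn.sub (hc.smul hu.contDiffOn)
  have hT0 : Set.MapsTo T Ω {0}ᶜ := by
    intro p hp
    have : T p = (Submodule.span ℝ {u p})ᗮ.reflection p.2 :=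
      (reflection_orthogonal_singleton_apply _ _).symm
    simpa [this] using hp.2
  have hΩ : IsOpen Ω :=
    (isOpen_ne.preimage hu.continuous).inter (isOpen_ne.preimage continuous_snd)
  have hU : IsOpen U := isOpen_ne.preimage (continuous_id.add continuous_const)
  have hw₀ : (w₀ : EuclideanSpace ℝ (Fin m)) ∈ U := by
    have := ne_zero_of_mem_unit_sphere w₀
    simp only [U, Set.mem_ofPred_eq, ← two_smul ℝ]
    exact smul_ne_zero two_ne_zero this
  have hΨ : ContDiffOn ℝ ∞
      (fun w => ∫ x : USphere m, radialExt f (T (w, x)) ∂(subsphereMeasure w₀)) U :=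
    contDiffOn_integral (subsphereMeasure w₀) hU hΩ continuous_subtype_val
      (fun w hw x => ⟨hw, ne_zero_of_mem_unit_sphere x⟩) (hf.smoothRadial.contDiffOn.comp hT hT0)
  have heq : FunkTransform.radon f =
      (fun w => ∫ x : USphere m, radialExt f (T (w, x)) ∂(subsphereMeasure w₀)) ∘
        ((↑) : USphere m → EuclideanSpace ℝ (Fin m)) := by
    funext w
    rw [FunkTransform.radon, subsphereMeasure_eq_map w₀ w,
      integral_map (continuous_sphereMap _).measurable.aemeasurable
        hf.continuous.aestronglyMeasurable]
    refine integral_congr_ae (.of_forall fun x => ?_)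
    change _ = radialExt f (T (w, x))
    rw [show T (w, x) = sphereMap (swapReflection w₀ w) x from (swapReflection_apply _ _ _).symm,
      radialExt_coe]
  rw [heq]
  exact (hΨ.contDiffAt (hU.mem_nhds hw₀)).contMDiffAt.comp w₀ (contMDiff_coe_sphere w₀)

lemma Smooth.dualRadon [NeZero m] {f : USphere m → ℂ} (hf : Smooth f) : Smooth (dualRadon f) :=
  ((contDiff_const (c := ((sphereArea (m - 1) : ℝ) : ℂ)⁻¹)).mul contDiff_id).contMDiff.comp hf.radon

/-- On degree-zero homogeneous functions the Euler terms of `ambientLB` vanish. -/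
lemma laplaceBeltrami_eq_laplacian [NeZero m] {f : USphere m → ℂ} (hf : Smooth f)
    (x : USphere m) :
    laplaceBeltrami f x = Laplacian.laplacian (radialExt f) (x : EuclideanSpace ℝ (Fin m)) := by
  have he' : euler (radialExt f) = fun _ => 0 := funext hf.smoothRadial.fderiv_self
  rw [laplaceBeltrami, ambientLB, he']
  simp [euler]

lemma Smooth.laplaceBeltrami [NeZero m] {f : USphere m → ℂ} (hf : Smooth f) :
    Smooth (laplaceBeltrami f) :=
  smooth_of_contDiffOn (fun x => (contDiffOn_laplacian isOpen_compl_singleton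
    hf.smoothRadial.contDiffOn).contDiffAt
      (isOpen_compl_singleton.mem_nhds (ne_zero_of_mem_unit_sphere x)))
    fun x => (laplaceBeltrami_eq_laplacian hf x).symm

end RadialExt

/-! ### Green's formula on the sphere -/

section Green

variable {V : Type*} [NormedAddCommGroup V] [InnerProductSpace ℝ V]

/-- A bump function on the line around `1`, vanishing near `0`. -/
noncomputable def shellBump : ContDiffBump (1 : ℝ) := ⟨1 / 4, 1 / 2, by norm_num, by norm_num⟩

/-- A smooth radial cut-off function, supported in a shell around the unit sphere. -/
noncomputable def shellCutoff (V : Type*) [NormedAddCommGroup V] [InnerProductSpace ℝ V] (y : V) :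
    ℝ := shellBump (‖y‖ ^ 2)

lemma contDiff_shellCutoff : ContDiff ℝ ∞ (shellCutoff V) :=
  (ContDiffBump.contDiff _).comp (contDiff_norm_sq ℝ)

lemma shellCutoff_nonneg (y : V) : 0 ≤ shellCutoff V y := ContDiffBump.nonneg _

lemma shellCutoff_of_norm_eq_one {y : V} (hy : ‖y‖ = 1) : shellCutoff V y = 1 :=
  ContDiffBump.one_of_mem_closedBall _ (by rw [hy, one_pow]; simp [shellBump])

lemma shellCutoff_congr {y z : V} (h : ‖y‖ = ‖z‖) : shellCutoff V y = shellCutoff V z := by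
  rw [shellCutoff, shellCutoff, h]

lemma tsupport_shellCutoff_subset :
    tsupport (shellCutoff V) ⊆ {y | ‖y‖ ^ 2 ∈ Set.Icc (1 / 2 : ℝ) (3 / 2)} := by
  refine closure_minimal (fun y hy => ?_)
    (isClosed_Icc.preimage (f := fun y : V => ‖y‖ ^ 2) (by fun_prop))
  have : ‖y‖ ^ 2 ∈ Function.support shellBump := hy
  rw [ContDiffBump.support_eq, mem_ball, Real.dist_eq, abs_lt] at this
  simp only [shellBump] at this
  constructor <;> linarith [this.1, this.2]

lemma ne_zero_of_mem_tsupport_shellCutoff {y : V} (hy : y ∈ tsupport (shellCutoff V)) : y ≠ 0 := by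
  rintro rfl
  have := (tsupport_shellCutoff_subset hy).1
  norm_num at this

lemma hasCompactSupport_shellCutoff [FiniteDimensional ℝ V] :
    HasCompactSupport (shellCutoff V) := by
  have : ProperSpace V := FiniteDimensional.proper ℝ V
  refine (isCompact_closedBall (0 : V) 2).of_isClosed_subset (isClosed_tsupport _) fun y hy => ?_
  have := (tsupport_shellCutoff_subset hy).2
  rw [mem_closedBall_zero_iff]
  nlinarith [norm_nonneg y]

lemma continuous_mul_of_tsupport {V R : Type*} [NormedAddCommGroup V] [NormedRing R] {χ k : V → R}
    (hχ : Continuous χ)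
    (h0 : ∀ y ∈ tsupport χ, y ≠ 0) (hk : ContinuousOn k {0}ᶜ) :
    Continuous fun y => χ y * k y := by
  rw [continuous_iff_continuousAt]
  intro y
  by_cases hy : y = 0
  · have hn : y ∉ tsupport χ := fun h => h0 y h hy
    refine (continuousAt_const (y := (0 : R))).congr ?_
    filter_upwards [(isClosed_tsupport χ).isOpen_compl.mem_nhds hn] with z hz
    rw [image_eq_zero_of_notMem_tsupport hz, zero_mul]
  · exact hχ.continuousAt.mul (hk.continuousAt (isOpen_compl_singleton.mem_nhds hy))

variable [FiniteDimensional ℝ V] [MeasurableSpace V] [BorelSpace V]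

lemma integrable_mul_of_tsupport {χ k : V → ℂ} (hχ : Continuous χ) (hc : HasCompactSupport χ)
    (h0 : ∀ y ∈ tsupport χ, y ≠ 0) (hk : ContinuousOn k {0}ᶜ) :
    Integrable (fun y => χ y * k y) :=
  (continuous_mul_of_tsupport hχ h0 hk).integrable_of_hasCompactSupport hc.mul_right

/-- Integration in polar coordinates of a function of degree `-2` against the radial cut-off. -/
lemma exists_integral_shellCutoff_mul :
    ∃ A : ℂ, ∀ k : V → ℂ, (∀ r : ℝ, 0 < r → ∀ y, k (r • y) = ((r ^ 2)⁻¹ : ℝ) * k y) →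
      ∫ y, (shellCutoff V y : ℂ) * k y =
        (∫ x : sphere (0 : V) 1, k x ∂(volume : Measure V).toSphere) * A := by
  rcases subsingleton_or_nontrivial V with hV | hV
  · refine ⟨0, fun k _ => ?_⟩
    have : ∀ y : V, shellCutoff V y = 0 := fun y => by
      refine image_eq_zero_of_notMem_tsupport fun hy => ?_
      exact ne_zero_of_mem_tsupport_shellCutoff hy (Subsingleton.elim _ _)
    simp [this]
  obtain ⟨v, hv⟩ := exists_norm_eq V zero_le_one
  refine ⟨∫ r : Set.Ioi (0 : ℝ), (shellCutoff V ((r : ℝ) • v) : ℂ) * (((r : ℝ) ^ 2)⁻¹ : ℝ)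
    ∂(Measure.volumeIoiPow (Module.finrank ℝ V - 1)), fun k hk => ?_⟩
  rw [← integral_prod_mul (fun x : sphere (0 : V) 1 => k x)]
  rw [← (volume : Measure V).measurePreserving_homeomorphUnitSphereProd.integral_comp
    (Homeomorph.measurableEmbedding _)]
  have h0 : ∫ y, (shellCutoff V y : ℂ) * k y =
      ∫ y in ({0}ᶜ : Set V), (shellCutoff V y : ℂ) * k y := by
    rw [restrict_compl_singleton]
  rw [h0, ← integral_subtype_comap (measurableSet_singleton (0 : V)).compl
    (fun y => (shellCutoff V y : ℂ) * k y)]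
  refine integral_congr_ae (.of_forall fun y => ?_)
  have hy : 0 < ‖(y : V)‖ := norm_pos_iff.2 y.2
  have h1 : shellCutoff V (‖(y : V)‖ • v) = shellCutoff V y :=
    shellCutoff_congr (by rw [norm_smul, hv, norm_norm, mul_one])
  have h2 := hk ‖(y : V)‖⁻¹ (inv_pos.2 hy) y
  simp only [homeomorphUnitSphereProd_apply_fst_coe, homeomorphUnitSphereProd_apply_snd_coe, h1, h2]
  have : (‖(y : V)‖ : ℂ) ≠ 0 := Complex.ofReal_ne_zero.2 hy.ne'
  push_cast
  field_simp

/-- A function of degree `-2` has integral zero over the sphere if its integral against the cut-off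
over the whole space vanishes. -/
lemma integral_sphere_eq_zero_of_shellCutoff {k : V → ℂ}
    (hk : ∀ r : ℝ, 0 < r → ∀ y, k (r • y) = ((r ^ 2)⁻¹ : ℝ) * k y)
    (h : ∫ y, (shellCutoff V y : ℂ) * k y = 0) :
    ∫ x : sphere (0 : V) 1, k x ∂(volume : Measure V).toSphere = 0 := by
  rcases subsingleton_or_nontrivial V with hV | hV
  · have : IsEmpty (sphere (0 : V) 1) := ⟨fun x =>
      ne_zero_of_mem_unit_sphere x (Subsingleton.elim _ _)⟩
    exact integral_of_isEmpty
  obtain ⟨A, hA⟩ := exists_integral_shellCutoff_mul (V := V)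
  rw [hA k hk] at h
  refine (mul_eq_zero.1 h).resolve_right fun hA0 => ?_
  -- The radial factor is non-zero, as the integral against `‖y‖⁻²` is positive.
  have h1 := hA (fun y => ((‖y‖ ^ 2)⁻¹ : ℝ)) fun r hr y => by
    rw [norm_smul, Real.norm_of_nonneg hr.le, mul_pow, mul_inv, Complex.ofReal_mul]
  rw [hA0, mul_zero] at h1
  have h2 : ∫ y, shellCutoff V y * (‖y‖ ^ 2)⁻¹ = 0 := by
    rw [← Complex.ofReal_eq_zero, ← integral_complex_ofReal, ← h1]
    simp
  obtain ⟨v, hv⟩ := exists_norm_eq V zero_le_one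
  have hcont : Continuous fun y : V => shellCutoff V y * (‖y‖ ^ 2)⁻¹ :=
    continuous_mul_of_tsupport contDiff_shellCutoff.continuous
      (fun y => ne_zero_of_mem_tsupport_shellCutoff) (ContinuousOn.inv₀ (by fun_prop) fun y hy => by
        simpa using hy)
  refine (hcont.integral_pos_of_hasCompactSupport_nonneg_nonzero (μ := volume)
    hasCompactSupport_shellCutoff.mul_right
    (fun y => mul_nonneg (shellCutoff_nonneg y) (by positivity)) (x := v) ?_).ne' h2
  simp [shellCutoff_of_norm_eq_one hv, hv]

/-- Green's formula on the sphere, for radially constant extensions. The ambient vector field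
`F ∇G - G ∇F` is tangential, so that it is not affected by a radial cut-off. -/
lemma integral_sphere_mul_laplacian {F G : V → ℂ} (hF : SmoothRadial F) (hG : SmoothRadial G) :
    ∫ x : sphere (0 : V) 1, (F x * Laplacian.laplacian G (x : V) -
      G x * Laplacian.laplacian F (x : V)) ∂(volume : Measure V).toSphere = 0 := by
  have hχ : ContDiff ℝ ∞ fun y : V => (shellCutoff V y : ℂ) :=
    Complex.ofRealCLM.contDiff.comp contDiff_shellCutoff
  have hχc : HasCompactSupport fun y : V => (shellCutoff V y : ℂ) :=
    hasCompactSupport_shellCutoff.comp_left (g := Complex.ofReal) Complex.ofReal_zero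
  have hχ0 : ∀ y ∈ tsupport fun y : V => (shellCutoff V y : ℂ), y ≠ 0 := fun y hy =>
    ne_zero_of_mem_tsupport_shellCutoff
      (tsupport_comp_subset Complex.ofReal_zero (shellCutoff V) hy)
  refine integral_sphere_eq_zero_of_shellCutoff (k := fun y => F y * Laplacian.laplacian G y -
    G y * Laplacian.laplacian F y) (fun r hr y => ?_) ?_
  · rw [hF.smul r hr, hG.smul r hr, hF.laplacian_smul hr, hG.laplacian_smul hr]
    ring
  let b := stdOrthonormalBasis ℝ V
  let W : V → V → ℂ := fun e y => F y * fderiv ℝ G y e - G y * fderiv ℝ F y e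
  let W' : V → V → ℂ := fun e y => F y * fderiv ℝ (fderiv ℝ G) y e e -
    G y * fderiv ℝ (fderiv ℝ F) y e e
  have hW : ∀ e, ContDiffOn ℝ ∞ (W e) {0}ᶜ := fun e =>
    (hF.contDiffOn.mul (hG.contDiffOn_fderiv.clm_apply contDiffOn_const)).sub
      (hG.contDiffOn.mul (hF.contDiffOn_fderiv.clm_apply contDiffOn_const))
  have hWd : ∀ e y, y ≠ 0 → HasFDerivAt (W e) (fderiv ℝ (W e) y) y := fun e y hy =>
    (((hW e).contDiffAt (isOpen_compl_singleton.mem_nhds hy)).differentiableAt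
      (by simp)).hasFDerivAt
  have hWfd : ∀ e y, y ≠ 0 → fderiv ℝ (W e) y e = W' e y := by
    intro e y hy
    have h := ((hF.hasFDerivAt hy).mul ((hG.hasFDerivAt_fderiv hy).clm_apply
      (hasFDerivAt_const e y))).sub ((hG.hasFDerivAt hy).mul
        ((hF.hasFDerivAt_fderiv hy).clm_apply (hasFDerivAt_const e y)))
    rw [(hWd e y hy).unique h]
    simp [W']
    ring
  have hWf : ∀ e, ContinuousOn (fun y => fderiv ℝ (W e) y e) {0}ᶜ := fun e =>
    (((contDiffOn_infty_iff_fderiv_of_isOpen isOpen_compl_singleton).1 (hW e)).2.clm_apply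
      contDiffOn_const).continuousOn
  have hfχ : Continuous (fderiv ℝ fun y : V => (shellCutoff V y : ℂ)) :=
    hχ.continuous_fderiv (by simp)
  have hint : ∀ e, Integrable fun y => (shellCutoff V y : ℂ) * fderiv ℝ (W e) y e := fun e =>
    integrable_mul_of_tsupport hχ.continuous hχc hχ0 (hWf e)
  have hint' : ∀ e, Integrable fun y =>
      fderiv ℝ (fun y : V => (shellCutoff V y : ℂ)) y e * W e y := fun e =>
    integrable_mul_of_tsupport (hfχ.clm_apply continuous_const)
      ((hχc.fderiv ℝ).comp_left (g := fun L : V →L[ℝ] ℂ => L e) (by simp))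
      (fun y hy => hχ0 y (tsupport_fderiv_subset ℝ
        (tsupport_comp_subset (g := fun L : V →L[ℝ] ℂ => L e) (by simp) _ hy)))
      (hW e).continuousOn
  have hibp : ∀ e, ∫ y, (shellCutoff V y : ℂ) * fderiv ℝ (W e) y e =
      - ∫ y, fderiv ℝ (fun y : V => (shellCutoff V y : ℂ)) y e * W e y := fun e =>
    integral_mul_fderiv_eq_neg_fderiv_mul_of_integrable (hint' e) (hint e)
      (integrable_mul_of_tsupport hχ.continuous hχc hχ0 (hW e).continuousOn)
      (fun y _ => hχ.differentiable (by simp) y)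
      fun y hy => (hWd e y (hχ0 y hy)).differentiableAt
  -- The integrand is the cut-off times the divergence of `F ∇G - G ∇F`.
  have hsum : ∀ y, (shellCutoff V y : ℂ) * (F y * Laplacian.laplacian G y -
      G y * Laplacian.laplacian F y) =
      ∑ i, (shellCutoff V y : ℂ) * fderiv ℝ (W (b i)) y (b i) := by
    intro y
    by_cases hy : y = 0
    · have : shellCutoff V y = 0 := image_eq_zero_of_notMem_tsupport fun h =>
        ne_zero_of_mem_tsupport_shellCutoff h hy
      simp [this]
    · simp only [hWfd _ y hy, W', laplacian_eq_sum b, Finset.mul_sum, ← Finset.sum_sub_distrib]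
  -- The gradient of the cut-off is radial, whereas `∇F` and `∇G` have no radial component.
  have htan : ∀ y, ∑ i, fderiv ℝ (fun y : V => (shellCutoff V y : ℂ)) y (b i) * W (b i) y = 0 := by
    intro y
    obtain ⟨c, hc⟩ : ∃ c : ℝ, ∀ e : V,
        fderiv ℝ (fun y : V => (shellCutoff V y : ℂ)) y e = ((c * inner ℝ e y : ℝ) : ℂ) := by
      have h1 : HasFDerivAt (fun y : V => (shellCutoff V y : ℂ)) (Complex.ofRealCLM.comp
          (deriv shellBump (‖y‖ ^ 2) • 2 • innerSL ℝ y)) y :=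
        Complex.ofRealCLM.hasFDerivAt.comp y
          (((shellBump.contDiff (n := 1)).differentiable (by simp) _).hasDerivAt.comp_hasFDerivAt
            y (hasStrictFDerivAt_norm_sq y).hasFDerivAt)
      refine ⟨deriv shellBump (‖y‖ ^ 2) * 2, fun e => ?_⟩
      rw [h1.fderiv, real_inner_comm]
      simp [mul_assoc]
    let L : V →L[ℝ] ℂ := F y • fderiv ℝ G y - G y • fderiv ℝ F y
    have hL : ∀ e, W e y = L e := fun e => rfl
    have : ∀ i, fderiv ℝ (fun y : V => (shellCutoff V y : ℂ)) y (b i) * W (b i) y =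
        (c : ℂ) * L ((inner ℝ (b i) y : ℝ) • b i) := by
      intro i
      rw [hc, hL, map_smul, Complex.real_smul, Complex.ofReal_mul, mul_assoc]
    simp only [this]
    rw [← Finset.mul_sum, ← map_sum, b.sum_repr']
    simp [L, hF.fderiv_self, hG.fderiv_self]
  simp only [hsum]
  rw [integral_finsetSum _ fun i _ => hint (b i)]
  simp only [hibp]
  rw [Finset.sum_neg_distrib, ← integral_finsetSum _ fun i _ => hint' (b i)]
  simp only [htan, integral_zero, neg_zero]

end Green

/-! ### The Laplacian of a zonal function -/

section Zonal

variable {V : Type*} [NormedAddCommGroup V] [InnerProductSpace ℝ V]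

/-- The radially constant extension of the zonal function `x ↦ q (⟪x, y⟫ ^ 2)` on the unit
sphere. -/
noncomputable def zonalExt (q : ℝ[X]) (y x : V) : ℂ :=
  ((q.eval (inner ℝ x y ^ 2 / ‖x‖ ^ 2) : ℝ) : ℂ)

lemma zonalExt_smoothRadial (q : ℝ[X]) (y : V) : SmoothRadial (zonalExt q y) := by
  constructor
  · have h : ContDiffOn ℝ ∞ (fun x : V => inner ℝ x y ^ 2 / ‖x‖ ^ 2) {0}ᶜ :=
      ((contDiff_id.inner ℝ contDiff_const).pow 2).contDiffOn.div (contDiff_norm_sq ℝ).contDiffOn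
        fun x hx => by simpa using hx
    have hq : ContDiff ℝ ∞ fun s : ℝ => q.eval s := by simpa using q.contDiff_aeval (𝕜 := ℝ) ∞
    exact (Complex.ofRealCLM.contDiff.comp hq).comp_contDiffOn h
  · intro r hr x
    have := hr.ne'
    rw [zonalExt, zonalExt, real_inner_smul_left, norm_smul, Real.norm_of_nonneg hr.le, mul_pow,
      mul_pow, mul_div_mul_left _ _ (by positivity)]

/-- The second derivative in the direction `e` may be computed along the line through `x`. -/
lemma fderiv_fderiv_eq {F : V → ℂ} (hF : SmoothRadial F) {x e : V} (hx : x ≠ 0)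
    {φ₁ : ℝ → ℂ} {φ₂ : ℂ} (h1 : ∀ᶠ t in nhds (0 : ℝ), HasDerivAt (fun t => F (x + t • e)) (φ₁ t) t)
    (h2 : HasDerivAt φ₁ φ₂ 0) : fderiv ℝ (fderiv ℝ F) x e e = φ₂ := by
  have hl : ∀ t : ℝ, HasDerivAt (fun t : ℝ => x + t • e) e t := fun t => by
    simpa using ((hasDerivAt_id t).smul_const e).const_add x
  have hc : ContinuousAt (fun t : ℝ => x + t • e) 0 := (hl 0).continuousAt
  have hne : ∀ᶠ t in nhds (0 : ℝ), x + t • e ≠ 0 :=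
    hc.eventually_ne (by simpa using hx)
  have h3 : HasDerivAt (fun t : ℝ => fderiv ℝ F (x + t • e) e)
      (fderiv ℝ (fderiv ℝ F) x e e) 0 := by
    have h' : HasFDerivAt (fderiv ℝ F) (fderiv ℝ (fderiv ℝ F) x) (x + (0 : ℝ) • e) := by
      rw [zero_smul, add_zero]
      exact hF.hasFDerivAt_fderiv hx
    have h4 : HasDerivAt (fun t : ℝ => fderiv ℝ F (x + t • e)) (fderiv ℝ (fderiv ℝ F) x e) 0 :=
      h'.comp_hasDerivAt (0 : ℝ) (hl 0)
    exact (ContinuousLinearMap.apply ℝ ℂ e).hasFDerivAt.comp_hasDerivAt (0 : ℝ) h4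
  refine h3.unique (h2.congr_of_eventuallyEq ?_)
  filter_upwards [h1, hne] with t ht hnt
  exact ((hF.hasFDerivAt hnt).comp_hasDerivAt t (hl t)).unique ht

variable [FiniteDimensional ℝ V]

/-- The Laplacian of a zonal function: in the variable `s = ⟪x, y⟫ ^ 2` it is a second order
operator of hypergeometric type. -/
lemma laplacian_zonalExt (q : ℝ[X]) (y : V) {x : V} (hx : ‖x‖ = 1) :
    Laplacian.laplacian (zonalExt q y) x =
      ((4 * inner ℝ x y ^ 2 * (‖y‖ ^ 2 - inner ℝ x y ^ 2) *
          q.derivative.derivative.eval (inner ℝ x y ^ 2) +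
        (2 * ‖y‖ ^ 2 - 2 * Module.finrank ℝ V * inner ℝ x y ^ 2) *
          q.derivative.eval (inner ℝ x y ^ 2) : ℝ) : ℂ) := by
  have hx0 : x ≠ 0 := norm_ne_zero_iff.1 (by simp [hx])
  let b := stdOrthonormalBasis ℝ V
  set a : ℝ := inner ℝ x y with ha
  have key : ∀ i, fderiv ℝ (fderiv ℝ (zonalExt q y)) x (b i) (b i) =
      ((q.derivative.derivative.eval (a ^ 2) *
          (2 * a * inner ℝ (b i) y - 2 * a ^ 2 * inner ℝ (b i) x) ^ 2 +
        q.derivative.eval (a ^ 2) * (2 * inner ℝ (b i) y ^ 2 - 2 * a ^ 2 -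
          8 * a * (inner ℝ x (b i) * inner ℝ (b i) y) + 8 * a ^ 2 * inner ℝ (b i) x ^ 2) : ℝ) :
          ℂ) := by
    intro i
    set β : ℝ := inner ℝ (b i) y with hβ
    set γ : ℝ := inner ℝ (b i) x with hγ
    have hγ' : inner ℝ x (b i) = γ := real_inner_comm _ _
    let A : ℝ → ℝ := fun t => a + t * β
    let B : ℝ → ℝ := fun t => 1 + 2 * t * γ + t ^ 2
    have hA : ∀ t, HasDerivAt A β t := fun t => by
      have h := ((hasDerivAt_id t).mul_const β).const_add a
      rw [one_mul] at h
      exact h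
    have hB : ∀ t, HasDerivAt B (2 * γ + 2 * t) t := fun t => by
      have h := ((((hasDerivAt_id t).const_mul 2).mul_const γ).const_add 1).add (hasDerivAt_pow 2 t)
      convert! h using 1
      simp
    have hcurve : ∀ t : ℝ, zonalExt q y (x + t • b i) = ((q.eval (A t ^ 2 / B t) : ℝ) : ℂ) := by
      intro t
      rw [zonalExt, inner_add_left, real_inner_smul_left, norm_add_sq_real, hx, norm_smul,
        b.norm_eq_one, real_inner_smul_right, hγ']
      congr 3
      simp only [B, Real.norm_eq_abs, mul_one, sq_abs]
      ring
    let S' : ℝ → ℝ := fun t => (2 * A t * β * B t - A t ^ 2 * (2 * γ + 2 * t)) / B t ^ 2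
    have hS : ∀ t, B t ≠ 0 → HasDerivAt (fun t => A t ^ 2 / B t) (S' t) t := by
      intro t ht
      convert! ((hA t).pow 2).div (hB t) ht using 1
      simp [S']
    have hB0 : B 0 = 1 := by simp [B]
    have hA0 : A 0 = a := by simp [A]
    have hne : ∀ᶠ t in nhds (0 : ℝ), B t ≠ 0 :=
      (hB 0).continuousAt.eventually_ne (by simp [hB0])
    refine fderiv_fderiv_eq (zonalExt_smoothRadial q y) hx0
      (φ₁ := fun t => ((q.derivative.eval (A t ^ 2 / B t) * S' t : ℝ) : ℂ)) ?_ ?_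
    · filter_upwards [hne] with t ht
      simp only [hcurve]
      exact ((q.hasDerivAt _).comp t (hS t ht)).ofReal_comp
    · have hN : HasDerivAt (fun t => 2 * A t * β * B t - A t ^ 2 * (2 * γ + 2 * t))
          (2 * β ^ 2 + 2 * a * β * (2 * γ) - (2 * a * β * (2 * γ) + a ^ 2 * 2)) 0 := by
        have h := ((((hA 0).const_mul 2).mul_const β).mul (hB 0)).sub
          (((hA 0).pow 2).mul (((hasDerivAt_id (0 : ℝ)).const_mul 2).const_add (2 * γ)))
        convert! h using 1
        simp [hA0, hB0]
        ring
      have hS0 := hS 0 (by simp [hB0])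
      have hS2 := hN.div ((hB 0).pow 2) (by simp [hB0])
      have := (((q.derivative.hasDerivAt _).comp (0 : ℝ) hS0).mul hS2).ofReal_comp
      convert! this using 1
      congr 1
      simp only [S', hA0, hB0, Function.comp, hγ']
      simp
      ring
  rw [laplacian_eq_sum b]
  simp only [key]
  rw [← Complex.ofReal_sum]
  congr 1
  have s1 : ∑ i, inner ℝ (b i) y ^ 2 = ‖y‖ ^ 2 := b.sum_sq_inner_right y
  have s2 : ∑ i, inner ℝ (b i) x ^ 2 = 1 := by rw [b.sum_sq_inner_right x, hx, one_pow]
  have s3 : ∑ i, inner ℝ x (b i) * inner ℝ (b i) y = a := b.sum_inner_mul_inner x y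
  have s4 : ∀ i, inner ℝ (b i) x = inner ℝ x (b i) := fun i => real_inner_comm _ _
  have expand : ∀ i, q.derivative.derivative.eval (a ^ 2) *
          (2 * a * inner ℝ (b i) y - 2 * a ^ 2 * inner ℝ (b i) x) ^ 2 +
        q.derivative.eval (a ^ 2) * (2 * inner ℝ (b i) y ^ 2 - 2 * a ^ 2 -
          8 * a * (inner ℝ x (b i) * inner ℝ (b i) y) + 8 * a ^ 2 * inner ℝ (b i) x ^ 2) =
      (4 * a ^ 2 * q.derivative.derivative.eval (a ^ 2) + 2 * q.derivative.eval (a ^ 2)) *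
          inner ℝ (b i) y ^ 2 +
        (4 * a ^ 4 * q.derivative.derivative.eval (a ^ 2) + 8 * a ^ 2 * q.derivative.eval (a ^ 2)) *
          inner ℝ (b i) x ^ 2 -
        (8 * a ^ 3 * q.derivative.derivative.eval (a ^ 2) + 8 * a * q.derivative.eval (a ^ 2)) *
          (inner ℝ x (b i) * inner ℝ (b i) y) - 2 * a ^ 2 * q.derivative.eval (a ^ 2) := by
    intro i
    rw [s4]
    ring
  simp only [expand]
  rw [Finset.sum_sub_distrib, Finset.sum_sub_distrib, Finset.sum_add_distrib, ← Finset.mul_sum,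
    ← Finset.mul_sum, ← Finset.mul_sum, s1, s2, s3, Finset.sum_const, Finset.card_univ,
    Fintype.card_fin, nsmul_eq_mul]
  ring

end Zonal

/-! ### Moments of the sphere -/

section Moments

/-- The integral of `⟪x, y⟫ ^ (2 * k)` over the unit sphere of a space of dimension `d`, for a unit
vector `y`. -/
noncomputable def sphereMoment (d k : ℕ) : ℝ :=
  sphereArea d * ∏ j ∈ Finset.range k, ((2 * j + 1 : ℝ) / (2 * j + d))

lemma sphereMoment_succ {d : ℕ} (hd : 0 < d) (k : ℕ) :
    (2 * k + d) * sphereMoment d (k + 1) = (2 * k + 1) * sphereMoment d k := by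
  rw [sphereMoment, sphereMoment, Finset.prod_range_succ]
  have : (2 * k + d : ℝ) ≠ 0 := by positivity
  field_simp

variable {V : Type*} [NormedAddCommGroup V] [InnerProductSpace ℝ V] [FiniteDimensional ℝ V]
  [MeasurableSpace V] [BorelSpace V]

lemma integrable_sphere_of_continuous {f : sphere (0 : V) 1 → ℝ} (hf : Continuous f) :
    Integrable f (volume : Measure V).toSphere := by
  have : ProperSpace V := FiniteDimensional.proper ℝ V
  exact hf.integrable_of_hasCompactSupport (HasCompactSupport.of_compactSpace _)

/-- The recursion comes from integrating the Laplacian of `⟪x, y⟫ ^ (2 * (k + 1))`. -/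
lemma integral_sphere_inner_pow (hd : 0 < Module.finrank ℝ V) (y : V) (k : ℕ) :
    ∫ x : sphere (0 : V) 1, (inner ℝ (x : V) y ^ 2) ^ k ∂(volume : Measure V).toSphere =
      (‖y‖ ^ 2) ^ k * sphereMoment (Module.finrank ℝ V) k := by
  induction k with
  | zero =>
    simp only [pow_zero, one_mul, integral_const, smul_eq_mul, mul_one, sphereMoment,
      Finset.range_zero, Finset.prod_empty]
    rw [measureReal_def, toSphere_univ, ENNReal.toReal_ofReal (sphereArea_nonneg _)]
  | succ k ih =>
    have hg := integral_sphere_mul_laplacian (SmoothRadial.const (V := V) 1)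
      (zonalExt_smoothRadial (Polynomial.X ^ (k + 1)) y)
    have hint : ∀ k : ℕ, Integrable (fun x : sphere (0 : V) 1 => (inner ℝ (x : V) y ^ 2) ^ k)
        (volume : Measure V).toSphere := fun k =>
      integrable_sphere_of_continuous (by fun_prop)
    have hpt : ∀ x : sphere (0 : V) 1, (1 : ℂ) * Laplacian.laplacian
        (zonalExt (Polynomial.X ^ (k + 1)) y) (x : V) -
        zonalExt (Polynomial.X ^ (k + 1)) y (x : V) *
          Laplacian.laplacian (fun _ : V => (1 : ℂ)) (x : V) =
        (((2 * (k + 1) * (2 * k + 1) * ‖y‖ ^ 2) * (inner ℝ (x : V) y ^ 2) ^ k -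
          (2 * (k + 1) * (2 * k + Module.finrank ℝ V)) * (inner ℝ (x : V) y ^ 2) ^ (k + 1) : ℝ) :
          ℂ) := by
      intro x
      rw [laplacian_zonalExt _ _ (norm_eq_of_mem_sphere x), InnerProductSpace.laplacian_const]
      simp only [Pi.zero_apply, mul_zero, sub_zero, one_mul]
      congr 1
      rcases k with _ | k
      · simp
      · simp
        ring
    simp only [hpt] at hg
    rw [integral_complex_ofReal, Complex.ofReal_eq_zero, integral_sub ((hint k).const_mul _)
      ((hint (k + 1)).const_mul _), integral_const_mul, integral_const_mul, ih] at hg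
    have hrec := sphereMoment_succ hd k
    have h1 : (2 * (k + 1) * (2 * k + Module.finrank ℝ V) : ℝ) ≠ 0 := by positivity
    apply mul_left_cancel₀ h1
    rw [pow_succ (‖y‖ ^ 2)]
    linear_combination -hg - 2 * (k + 1) * (‖y‖ ^ 2) ^ k * ‖y‖ ^ 2 * hrec

end Moments

/-! ### Action on even zonal polynomials -/

section ZonalSphere

variable {m : ℕ}

/-- The even zonal polynomial `x ↦ q (⟪x, y⟫ ^ 2)` with axis `y`. -/
noncomputable def zonal (q : ℝ[X]) (y x : USphere m) : ℂ :=
  ((q.eval (inner ℝ (x : EuclideanSpace ℝ (Fin m)) (y : EuclideanSpace ℝ (Fin m)) ^ 2) : ℝ) : ℂ)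

lemma zonal_eq_zonalExt (q : ℝ[X]) (y x : USphere m) :
    zonal q y x = zonalExt q (y : EuclideanSpace ℝ (Fin m)) (x : EuclideanSpace ℝ (Fin m)) := by
  simp [zonal, zonalExt]

lemma smooth_zonal [NeZero m] (q : ℝ[X]) (y : USphere m) : Smooth (zonal q y) :=
  smooth_of_contDiffOn (fun x => (zonalExt_smoothRadial q (y : EuclideanSpace ℝ (Fin m))).contDiffAt
    (ne_zero_of_mem_unit_sphere x)) fun x => (zonal_eq_zonalExt q y x).symm

lemma radialExt_eq_of_smoothRadial {f : USphere m → ℂ} {F : EuclideanSpace ℝ (Fin m) → ℂ}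
    (hF : SmoothRadial F) (h : ∀ x : USphere m, F x = f x) {y : EuclideanSpace ℝ (Fin m)}
    (hy : y ≠ 0) : radialExt f y = F y := by
  rw [radialExt_of_ne_zero f hy, ← h]
  exact hF.smul _ (inv_pos.2 (norm_pos_iff.2 hy)) y

/-- The Laplace-Beltrami operator on even zonal polynomials in the variable `s = ⟪x, y⟫ ^ 2`. -/
noncomputable def zonalLaplacian (m : ℕ) : ℝ[X] →ₗ[ℝ] ℝ[X] :=
  LinearMap.mulLeft ℝ (4 * Polynomial.X * (1 - Polynomial.X)) ∘ₗ
      (Polynomial.derivative ∘ₗ Polynomial.derivative) +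
    LinearMap.mulLeft ℝ (2 - Polynomial.C (2 * (m : ℝ)) * Polynomial.X) ∘ₗ Polynomial.derivative

lemma zonalLaplacian_apply (q : ℝ[X]) : zonalLaplacian m q =
    4 * Polynomial.X * (1 - Polynomial.X) * q.derivative.derivative +
      (2 - Polynomial.C (2 * (m : ℝ)) * Polynomial.X) * q.derivative := rfl

lemma laplaceBeltrami_zonal [NeZero m] (q : ℝ[X]) (y : USphere m) :
    laplaceBeltrami (zonal q y) = zonal (zonalLaplacian m q) y := by
  funext x
  rw [laplaceBeltrami_eq_laplacian (smooth_zonal q y)]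
  have hx := ne_zero_of_mem_unit_sphere x
  have heq : radialExt (zonal q y) =ᶠ[nhds (x : EuclideanSpace ℝ (Fin m))]
      zonalExt q (y : EuclideanSpace ℝ (Fin m)) := by
    filter_upwards [isOpen_ne.mem_nhds hx] with z hz
    exact radialExt_eq_of_smoothRadial (zonalExt_smoothRadial q _)
      (fun x => (zonal_eq_zonalExt q y x).symm) hz
  rw [(InnerProductSpace.laplacian_congr_nhds heq).eq_of_nhds,
    laplacian_zonalExt _ _ (norm_eq_of_mem_sphere x), zonal, zonalLaplacian_apply]
  simp [norm_eq_of_mem_sphere]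

/-- The Radon transform on even zonal polynomials in the variable `s = ⟪x, y⟫ ^ 2`; it maps `s ^ k`
to a multiple of `(1 - s) ^ k`. -/
noncomputable def zonalRadon (m : ℕ) : ℝ[X] →ₗ[ℝ] ℝ[X] :=
  Polynomial.lsum fun k => LinearMap.toSpanSingleton ℝ ℝ[X]
    (Polynomial.C (sphereMoment (m - 1) k) * (1 - Polynomial.X) ^ k)

lemma zonalRadon_monomial (k : ℕ) (a : ℝ) : zonalRadon m (Polynomial.monomial k a) =
    a • (Polynomial.C (sphereMoment (m - 1) k) * (1 - Polynomial.X) ^ k) := by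
  rw [zonalRadon, Polynomial.lsum_apply, Polynomial.sum_monomial_index _ _ (by simp)]
  simp

/-- On the hyperplane orthogonal to `w` the inner product with `y` is the one with the projection of
`y`, whose squared length is `1 - ⟪w, y⟫ ^ 2`. -/
lemma radon_zonal_monomial (hm : 2 ≤ m) (k : ℕ) (y w : USphere m) :
    ∫ x : USphere m, (inner ℝ (x : EuclideanSpace ℝ (Fin m))
      (y : EuclideanSpace ℝ (Fin m)) ^ 2) ^ k ∂(subsphereMeasure w) =
    sphereMoment (m - 1) k * (1 - inner ℝ (w : EuclideanSpace ℝ (Fin m))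
      (y : EuclideanSpace ℝ (Fin m)) ^ 2) ^ k := by
  let H := hyperplane w
  let z : H := H.orthogonalProjectionOnto (y : EuclideanSpace ℝ (Fin m))
  have hz : ‖z‖ ^ 2 = 1 - inner ℝ (w : EuclideanSpace ℝ (Fin m))
      (y : EuclideanSpace ℝ (Fin m)) ^ 2 := by
    have h := Submodule.norm_sq_eq_add_norm_sq_starProjection (𝕜 := ℝ)
      (y : EuclideanSpace ℝ (Fin m)) (Submodule.span ℝ {(w : EuclideanSpace ℝ (Fin m))})
    rw [Submodule.starProjection_unit_singleton ℝ (norm_eq_of_mem_sphere w), norm_smul,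
      norm_eq_of_mem_sphere, norm_eq_of_mem_sphere, mul_one, Real.norm_eq_abs, sq_abs] at h
    change 1 ^ 2 = _ + ‖z‖ ^ 2 at h
    linarith
  rw [subsphereMeasure, integral_map (continuous_subsphereIncl w).measurable.aemeasurable
    (by fun_prop)]
  have hx : ∀ x : sphere (0 : H) 1, inner ℝ (subsphereIncl w x : EuclideanSpace ℝ (Fin m))
      (y : EuclideanSpace ℝ (Fin m)) = inner ℝ (x : H) z := by
    intro x
    exact (Submodule.inner_orthogonalProjectionOnto_eq_of_mem_left (x : H)
      (y : EuclideanSpace ℝ (Fin m))).symm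
  simp only [hx]
  rw [integral_sphere_inner_pow (by rw [finrank_hyperplane]; omega), finrank_hyperplane, hz,
    mul_comm]

lemma radon_zonal (hm : 2 ≤ m) (q : ℝ[X]) (y : USphere m) :
    radon (zonal q y) = zonal (zonalRadon m q) y := by
  funext w
  have hcont : ∀ q : ℝ[X], Continuous fun x : USphere m => q.eval
      (inner ℝ (x : EuclideanSpace ℝ (Fin m)) (y : EuclideanSpace ℝ (Fin m)) ^ 2) := fun q =>
    q.continuous.comp (by fun_prop)
  have hint : ∀ q : ℝ[X], Integrable (fun x : USphere m => q.eval
      (inner ℝ (x : EuclideanSpace ℝ (Fin m)) (y : EuclideanSpace ℝ (Fin m)) ^ 2))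
      (subsphereMeasure w) := fun q =>
    (hcont q).integrable_of_hasCompactSupport (HasCompactSupport.of_compactSpace _)
  simp only [radon, zonal]
  rw [integral_complex_ofReal]
  congr 1
  induction q using Polynomial.induction_on' with
  | add p q hp hq =>
    simp only [Polynomial.eval_add, map_add]
    rw [integral_add (hint p) (hint q), hp, hq]
  | monomial k a =>
    rw [zonalRadon_monomial]
    simp only [Polynomial.eval_monomial]
    rw [integral_const_mul, radon_zonal_monomial hm]
    simp

end ZonalSphere

/-! ### Triangular operators on polynomials -/

section Algebra

open Polynomial

/-- The endomorphism `A` of `ℝ[X]` is triangular in the monomial basis, with diagonal entries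
`d k`. -/
def IsTriangular (A : ℝ[X] →ₗ[ℝ] ℝ[X]) (d : ℕ → ℝ) : Prop :=
  ∀ k, A (X ^ k) - d k • X ^ k ∈ degreeLT ℝ k

namespace IsTriangular

variable {A B : ℝ[X] →ₗ[ℝ] ℝ[X]} {d e : ℕ → ℝ}

lemma mem_degreeLT (hA : IsTriangular A d) {n : ℕ} {p : ℝ[X]} (hp : p ∈ degreeLT ℝ n) :
    A p ∈ degreeLT ℝ n := by
  classical
  rw [degreeLT_eq_span_X_pow] at hp
  induction hp using Submodule.span_induction with
  | mem x hx =>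
    simp only [Finset.coe_image, Finset.coe_range, Set.mem_image, Set.mem_Iio] at hx
    obtain ⟨k, hk, rfl⟩ := hx
    have h1 : A (X ^ k) = (A (X ^ k) - d k • X ^ k) + d k • X ^ k := by abel
    rw [h1]
    refine Submodule.add_mem _ (degreeLT_mono hk.le (hA k)) (Submodule.smul_mem _ _ ?_)
    rw [Polynomial.mem_degreeLT, degree_X_pow]
    exact_mod_cast hk
  | zero => simp
  | add x y _ _ hx hy => rw [map_add]; exact Submodule.add_mem _ hx hy
  | smul a x _ hx => rw [map_smul]; exact Submodule.smul_mem _ _ hx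

lemma mul (hA : IsTriangular A d) (hB : IsTriangular B e) :
    IsTriangular (A * B) (fun k => d k * e k) := by
  intro k
  have : (A * B) (X ^ k) - (d k * e k) • X ^ k =
      A (B (X ^ k) - e k • X ^ k) + e k • (A (X ^ k) - d k • X ^ k) := by
    rw [Module.End.mul_apply, map_sub, map_smul, smul_sub, smul_smul, mul_comm (e k)]
    abel
  rw [this]
  exact Submodule.add_mem _ (hA.mem_degreeLT (hB k)) (Submodule.smul_mem _ _ (hA k))

lemma sub_algebraMap (hA : IsTriangular A d) (c : ℝ) :
    IsTriangular (A - algebraMap ℝ (Module.End ℝ ℝ[X]) c) (fun k => d k - c) := by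
  intro k
  have : (A - algebraMap ℝ (Module.End ℝ ℝ[X]) c) (X ^ k) - (d k - c) • X ^ k =
      A (X ^ k) - d k • X ^ k := by
    rw [LinearMap.sub_apply, Module.algebraMap_end_apply, sub_smul]
    abel
  rw [this]
  exact hA k

lemma one : IsTriangular 1 (fun _ => 1) := fun k => by simp

/-- A triangular operator with zero diagonal that commutes with a triangular operator with distinct
diagonal entries vanishes. -/
lemma eq_zero_of_commute (hA : IsTriangular A fun _ => 0) (hB : IsTriangular B e)
    (he : Function.Injective e) (hAB : A * B = B * A) : A = 0 := by
  have hcomm : ∀ p, A (B p) = B (A p) := fun p => LinearMap.congr_fun hAB p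
  have hX : ∀ k, A (X ^ k) = 0 := by
    intro k
    induction k using Nat.strong_induction_on with
    | _ k ih =>
    have hlt : ∀ p ∈ degreeLT ℝ k, A p = 0 := by
      classical
      intro p hp
      rw [degreeLT_eq_span_X_pow] at hp
      induction hp using Submodule.span_induction with
      | mem x hx =>
        simp only [Finset.coe_image, Finset.coe_range, Set.mem_image, Set.mem_Iio] at hx
        obtain ⟨j, hj, rfl⟩ := hx
        exact ih j hj
      | zero => simp
      | add x y _ _ hx hy => rw [map_add, hx, hy, add_zero]
      | smul a x _ hx => rw [map_smul, hx, smul_zero]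
    have heig : B (A (X ^ k)) = e k • A (X ^ k) := by
      rw [← hcomm, ← sub_eq_zero, ← map_smul, ← map_sub]
      exact hlt _ (hB k)
    by_contra hne
    -- The leading term of an eigenvector of `B` determines its eigenvalue.
    set q := A (X ^ k) with hq
    have hqk : q.natDegree < k := by
      have := hA k
      rw [zero_smul, sub_zero, Polynomial.mem_degreeLT] at this
      exact (natDegree_lt_iff_degree_lt hne).2 this
    set n := q.natDegree with hn
    have hlead : q - q.leadingCoeff • X ^ n ∈ degreeLT ℝ n := by
      rw [Polynomial.mem_degreeLT, smul_eq_C_mul, C_mul_X_pow_eq_monomial]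
      exact (degree_sub_lt_left (by rw [degree_monomial _ (leadingCoeff_ne_zero.2 hne),
        degree_eq_natDegree hne]) hne (by simp [hn])).trans_eq (degree_eq_natDegree hne)
    have h1 : B q - e n • q ∈ degreeLT ℝ n := by
      have : B q - e n • q = B (q - q.leadingCoeff • X ^ n) +
          q.leadingCoeff • (B (X ^ n) - e n • X ^ n) -
          e n • (q - q.leadingCoeff • X ^ n) := by
        rw [map_sub, map_smul, smul_sub, smul_sub, smul_comm (e n)]
        abel
      rw [this]
      exact Submodule.sub_mem _ (Submodule.add_mem _ (hB.mem_degreeLT hlead)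
        (Submodule.smul_mem _ _ (hB n))) (Submodule.smul_mem _ _ hlead)
    rw [heig, ← sub_smul, Polynomial.mem_degreeLT] at h1
    have h2 : e k - e n ≠ 0 := sub_ne_zero.2 fun h => hqk.ne' (he h)
    rw [degree_smul_of_smul_regular _ (IsSMulRegular.of_ne_zero h2), degree_eq_natDegree hne] at h1
    exact lt_irrefl _ h1
  ext k : 2
  simp [hX, ← X_pow_eq_monomial]

end IsTriangular

variable {m : ℕ}

lemma zonalLaplacian_X_pow (k : ℕ) : zonalLaplacian m (X ^ k) =
    (2 * k * (2 * k - 1) : ℝ) • X ^ (k - 1) + (-(2 * k * (2 * k + m - 2)) : ℝ) • X ^ k := by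
  rw [zonalLaplacian_apply]
  rcases k with _ | _ | k
  · simp
  · simp [smul_eq_C_mul, map_ofNat]
    ring
  · simp [smul_eq_C_mul, map_ofNat]
    ring

lemma zonalLaplacian_one_sub_X_pow (k : ℕ) : zonalLaplacian m ((1 - X) ^ k) =
    (2 * k * (2 * k + m - 3) : ℝ) • (1 - X) ^ (k - 1) +
      (-(2 * k * (2 * k + m - 2)) : ℝ) • (1 - X) ^ k := by
  rw [zonalLaplacian_apply]
  rcases k with _ | _ | k
  · simp
  · simp [smul_eq_C_mul, map_ofNat]
    ring
  · simp [smul_eq_C_mul, map_ofNat, derivative_pow]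
    ring

lemma zonalRadon_X_pow (k : ℕ) :
    zonalRadon m (X ^ k) = sphereMoment (m - 1) k • (1 - X) ^ k := by
  rw [X_pow_eq_monomial, zonalRadon_monomial, one_smul, smul_eq_C_mul]

lemma zonalLaplacian_isTriangular :
    IsTriangular (zonalLaplacian m) (fun k => -(2 * k * (2 * k + m - 2))) := by
  intro k
  rw [zonalLaplacian_X_pow, add_sub_cancel_right]
  rcases k with _ | k
  · simp
  refine Submodule.smul_mem _ _ ?_
  rw [Polynomial.mem_degreeLT, degree_X_pow]
  exact_mod_cast Nat.lt_succ_self k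

lemma zonalRadon_isTriangular :
    IsTriangular (zonalRadon m) (fun k => (-1) ^ k * sphereMoment (m - 1) k) := by
  intro k
  have h1 : (1 - X : ℝ[X]) ^ k = (-1 : ℝ) ^ k • (X - C 1) ^ k := by
    rw [← neg_sub X 1, neg_pow, smul_eq_C_mul]
    simp
  have h2 : ((X - C 1) ^ k - X ^ k : ℝ[X]) ∈ degreeLT ℝ k := by
    have hd : ((X - C 1) ^ k : ℝ[X]).degree = k := by
      rw [degree_pow, degree_X_sub_C, nsmul_one]
    rw [Polynomial.mem_degreeLT]
    exact (degree_sub_lt_left (by rw [hd, degree_X_pow]) ((monic_X_sub_C 1).pow k).ne_zero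
      (by rw [((monic_X_sub_C (1 : ℝ)).pow k).leadingCoeff, (monic_X_pow k).leadingCoeff])).trans_eq
        hd
  have h3 : zonalRadon m (X ^ k) - ((-1) ^ k * sphereMoment (m - 1) k) • X ^ k =
      ((-1) ^ k * sphereMoment (m - 1) k) • ((X - C 1) ^ k - X ^ k) := by
    rw [zonalRadon_X_pow, h1, smul_smul, smul_sub, mul_comm]
  rw [h3]
  exact Submodule.smul_mem _ _ h2

/-- The two operators commute: on `X ^ k` this is the recursion for the moments. -/
lemma zonalRadon_zonalLaplacian (hm : 2 ≤ m) :
    zonalRadon m * zonalLaplacian m = zonalLaplacian m * zonalRadon m := by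
  ext k : 2
  simp only [LinearMap.comp_apply, Module.End.mul_apply, ← X_pow_eq_monomial]
  rw [zonalRadon_X_pow, map_smul, zonalLaplacian_X_pow, zonalLaplacian_one_sub_X_pow, map_add,
    map_smul, map_smul, zonalRadon_X_pow, zonalRadon_X_pow, smul_add, smul_smul, smul_smul,
    smul_smul, smul_smul, mul_comm (-_ : ℝ)]
  congr 2
  rcases k with _ | k
  · simp
  have h := sphereMoment_succ (d := m - 1) (by omega) k
  rw [Nat.cast_sub (by omega)] at h
  push_cast at h ⊢
  linear_combination -(2 * (k + 1) : ℝ) * h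

lemma IsTriangular.aeval_prod {A : ℝ[X] →ₗ[ℝ] ℝ[X]} {d : ℕ → ℝ} (hA : IsTriangular A d)
    {ι : Type*} (s : Finset ι) (c : ι → ℝ) :
    IsTriangular (aeval A (∏ j ∈ s, (X - C (c j))))
      (fun k => (∏ j ∈ s, (X - C (c j))).eval (d k)) := by
  classical
  induction s using Finset.induction_on with
  | empty => simpa using IsTriangular.one
  | insert j s hj ih =>
    have := (hA.sub_algebraMap (c j)).mul ih
    simpa [Finset.prod_insert hj] using this

lemma Gamma_nat_add_half_mul (n : ℕ) : Real.Gamma (n + 1 / 2) * 2 ^ n =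
    (∏ j ∈ Finset.range n, (2 * j + 1 : ℝ)) * Real.sqrt Real.pi := by
  induction n with
  | zero => simp [-one_div, Real.Gamma_one_half_eq]
  | succ n ih =>
    rw [Nat.cast_succ, add_right_comm, Real.Gamma_add_one (by positivity), Finset.prod_range_succ]
    linear_combination (2 * n + 1 : ℝ) * ih

/-- The diagonal entries of `P(Δ) R²` are independent of the degree `k`, as
`∏ j < n, (2 k + 2 j + 1)` is inversely proportional to the moment of order `k`. -/
lemma helgasonPoly_eval_mul_sphereMoment_sq (hm : Even m) (hm0 : 2 ≤ m) (k : ℕ) :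
    (helgasonPoly m).eval (-(2 * (k : ℝ) * (2 * k + m - 2))) * sphereMoment (m - 1) k ^ 2 =
      helgasonConst m * sphereArea (m - 1) := by
  obtain ⟨n, rfl⟩ : ∃ n, m = 2 * n + 2 := by
    obtain ⟨r, hr⟩ := hm
    exact ⟨r - 1, by omega⟩
  -- `D k` is inversely proportional to the moment of order `k`, and `P` takes the value
  -- `± (D k) ^ 2` at the eigenvalue with index `k`.
  let D : ℕ → ℝ := fun k => ∏ j ∈ Finset.range n, (2 * k + 2 * j + 1 : ℝ)
  have hD : ∀ k : ℕ, D (k + 1) * (2 * k + 1) = D k * (2 * k + 2 * n + 1) := by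
    intro k
    have h1 := Finset.prod_range_succ (fun j : ℕ => (2 * k + 2 * j + 1 : ℝ)) n
    rw [Finset.prod_range_succ'] at h1
    rw [← h1]
    simp only [D]
    push_cast
    congr 1
    · exact Finset.prod_congr rfl fun j _ => by ring
    · ring
  have hDS : D k * sphereMoment (2 * n + 2 - 1) k = D 0 * sphereArea (2 * n + 1) := by
    induction k with
    | zero => simp [sphereMoment]
    | succ k ih =>
      rw [← ih]
      have h1 := sphereMoment_succ (d := 2 * n + 2 - 1) (by omega) k
      have h2 := hD k
      have h3 : (2 * k + 2 * n + 1 : ℝ) * (2 * k + 1) ≠ 0 := by positivity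
      apply mul_left_cancel₀ h3
      rw [show 2 * n + 2 - 1 = 2 * n + 1 from rfl] at h1 ⊢
      push_cast at h1
      linear_combination D (k + 1) * (2 * k + 1) * h1 + (2 * k + 1) *
        sphereMoment (2 * n + 1) k * h2
  have hP : (helgasonPoly (2 * n + 2)).eval
      (-(2 * (k : ℝ) * (2 * k + (2 * n + 2 : ℕ) - 2))) = (-1) ^ n * D k ^ 2 := by
    rw [helgasonPoly, eval_prod, show (2 * n + 2 - 2) / 2 = n by omega,
      ← Finset.Ico_succ_right_eq_Icc, Nat.succ_eq_succ, Finset.prod_Ico_eq_prod_range]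
    -- The factor of `P` with index `j` splits into `2 k + 2 j - 1` and `2 k + 2 (n - j) + 1`, so
    -- that one of the two copies of `D k` is multiplied in reverse order.
    have h1 : D k = ∏ j ∈ Finset.range n, (2 * k + 2 * (n - 1 - j : ℕ) + 1 : ℝ) :=
      (Finset.prod_range_reflect (fun j : ℕ => (2 * k + 2 * j + 1 : ℝ)) n).symm
    rw [sq]
    nth_rewrite 2 [h1]
    have h2 : (-1 : ℝ) ^ n = ∏ j ∈ Finset.range n, (-1 : ℝ) := by simp
    rw [h2, ← Finset.prod_mul_distrib, ← Finset.prod_mul_distrib, Nat.succ_eq_add_one,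
      Nat.add_sub_cancel]
    refine Finset.prod_congr rfl fun j hj => ?_
    rw [Finset.mem_range] at hj
    obtain ⟨i, rfl⟩ : ∃ i, n = j + 1 + i := ⟨n - (j + 1), by omega⟩
    rw [show j + 1 + i - 1 - j = i by omega]
    simp
    ring
  have hΓ : Real.Gamma (n + 1 / 2) * 2 ^ n = D 0 * Real.sqrt Real.pi := by
    rw [Gamma_nat_add_half_mul]
    simp [D]
  rw [hP, show (-1 : ℝ) ^ n * D k ^ 2 * sphereMoment (2 * n + 2 - 1) k ^ 2 =
    (-1) ^ n * (D k * sphereMoment (2 * n + 2 - 1) k) ^ 2 by ring, hDS, helgasonConst,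
    show (2 * n + 2 - 2) / 2 = n by omega, show 2 * n + 2 - 1 = 2 * n + 1 from rfl,
    show (((2 * n + 2 : ℕ) : ℝ) - 1) / 2 = n + 1 / 2 by push_cast; ring, Real.Gamma_one_half_eq]
  have hD0 : 0 < D 0 := Finset.prod_pos fun j _ => by positivity
  have hsqrt : 0 < Real.sqrt Real.pi := Real.sqrt_pos.2 Real.pi_pos
  have hΓ' : Real.Gamma (n + 1 / 2) = D 0 * Real.sqrt Real.pi / 2 ^ n := by
    rw [eq_div_iff (by positivity), hΓ]
  have hσ : sphereArea (2 * n + 1) = 2 * Real.pi ^ n * 2 ^ n / D 0 := by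
    rw [sphereArea, show (((2 * n + 1 : ℕ) : ℝ)) / 2 = n + 1 / 2 by push_cast; ring, hΓ',
      Real.rpow_add Real.pi_pos, Real.rpow_natCast, ← Real.sqrt_eq_rpow]
    field_simp
  rw [hσ, hΓ', show (-4 * Real.pi) = (-1) * (2 * 2) * Real.pi by ring, mul_pow, mul_pow, mul_pow]
  field_simp
  rw [← pow_mul, ← pow_mul, mul_comm]

lemma _root_.Commute.aeval_left {R A : Type*} [CommSemiring R] [Semiring A] [Algebra R A] {a b : A}
    (h : Commute a b) (p : R[X]) : Commute (aeval a p) b := by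
  induction p using Polynomial.induction_on' with
  | add p q hp hq => rw [map_add]; exact hp.add_left hq
  | monomial n c =>
    rw [aeval_monomial]
    exact (Algebra.commute_algebraMap_left c b).mul_left (h.pow_left n)

/-- The inversion formula on even zonal polynomials: `P(Δ) R²` has constant diagonal and commutes
with `Δ`, so that it is a scalar. -/
lemma helgasonPoly_zonal (hm : Even m) (hm0 : 2 ≤ m) :
    aeval (zonalLaplacian m) (helgasonPoly m) * (zonalRadon m * zonalRadon m) =
      algebraMap ℝ (Module.End ℝ ℝ[X]) (helgasonConst m * sphereArea (m - 1)) := by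
  rw [← sub_eq_zero]
  have hcomm := zonalRadon_zonalLaplacian hm0
  refine IsTriangular.eq_zero_of_commute (B := zonalLaplacian m) ?_
    zonalLaplacian_isTriangular ?_ ?_
  · have h := (zonalLaplacian_isTriangular (m := m)).aeval_prod (Finset.Icc 1 ((m - 2) / 2))
      fun j => ((m : ℝ) - 2 * (j : ℝ) - 1) * (2 * (j : ℝ) - 1)
    rw [← helgasonPoly] at h
    have h' := (h.mul ((zonalRadon_isTriangular (m := m)).mul
      (zonalRadon_isTriangular (m := m)))).sub_algebraMap (helgasonConst m * sphereArea (m - 1))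
    convert! h' using 2 with k
    rw [← helgasonPoly_eval_mul_sphereMoment_sq hm hm0 k]
    have : ((-1 : ℝ) ^ k) * (-1) ^ k = 1 := by rw [← mul_pow]; simp
    linear_combination -(eval (-(2 * k * (2 * k + m - 2) : ℝ)) (helgasonPoly m) *
      sphereMoment (m - 1) k ^ 2) * this
  · intro i j hij
    have hm' : (2 : ℝ) ≤ m := by exact_mod_cast hm0
    have h : ((i : ℝ) - j) * (2 * (i + j) + (m - 2)) = 0 := by linear_combination -hij / 2
    rcases mul_eq_zero.1 h with h | h
    · exact_mod_cast sub_eq_zero.1 h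
    · have h1 : (i : ℝ) = 0 := by linarith [i.cast_nonneg (α := ℝ), j.cast_nonneg (α := ℝ)]
      have h2 : (j : ℝ) = 0 := by linarith [i.cast_nonneg (α := ℝ), j.cast_nonneg (α := ℝ)]
      exact_mod_cast h1.trans h2.symm
  · have h1 : Commute (zonalRadon m) (zonalLaplacian m) := hcomm
    have h2 : Commute (aeval (zonalLaplacian m) (helgasonPoly m)) (zonalLaplacian m) :=
      (Commute.refl _).aeval_left _
    exact (h2.mul_left (h1.mul_left h1)).sub_left (Algebra.commute_algebraMap_left _ _)

/-- The operators in the opposite order; `R` commutes with `Δ`, hence with `P(Δ)`. -/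
lemma helgasonPoly_zonal_comm (hm : Even m) (hm0 : 2 ≤ m) :
    zonalRadon m * zonalRadon m * aeval (zonalLaplacian m) (helgasonPoly m) =
      algebraMap ℝ (Module.End ℝ ℝ[X]) (helgasonConst m * sphereArea (m - 1)) := by
  have h1 : Commute (zonalLaplacian m) (zonalRadon m * zonalRadon m) :=
    have h : Commute (zonalLaplacian m) (zonalRadon m) := (zonalRadon_zonalLaplacian hm0).symm
    h.mul_right h
  rw [← helgasonPoly_zonal hm hm0]
  exact (h1.aeval_left _).symm

end Algebra

/-! ### Totality of the even zonal polynomials -/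

section Density

variable {m : ℕ}

lemma integrable_of_continuous {E : Type*} [NormedAddCommGroup E] {f : USphere m → E}
    {μ : Measure (USphere m)} [IsFiniteMeasure μ] (hf : Continuous f) : Integrable f μ :=
  hf.integrable_of_hasCompactSupport (HasCompactSupport.of_compactSpace _)

instance : (surfaceMeasure m).IsOpenPosMeasure :=
  inferInstanceAs (volume : Measure (EuclideanSpace ℝ (Fin m))).toSphere.IsOpenPosMeasure

lemma inner_sq_mem_Icc (x y : USphere m) :
    inner ℝ (x : EuclideanSpace ℝ (Fin m)) (y : EuclideanSpace ℝ (Fin m)) ^ 2 ∈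
      Set.Icc (0 : ℝ) 1 := by
  refine ⟨sq_nonneg _, ?_⟩
  have := abs_real_inner_le_norm (x : EuclideanSpace ℝ (Fin m)) (y : EuclideanSpace ℝ (Fin m))
  rw [norm_eq_of_mem_sphere, norm_eq_of_mem_sphere, mul_one] at this
  exact (sq_le_one_iff_abs_le_one _).2 this

/-- By the Weierstrass theorem, orthogonality to zonal polynomials extends to continuous zonal
functions. -/
lemma integral_mul_zonal_continuous {g : USphere m → ℝ} (hg : Continuous g) (y : USphere m)
    (h : ∀ p : ℝ[X], ∫ x, g x * p.eval (inner ℝ (x : EuclideanSpace ℝ (Fin m))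
      (y : EuclideanSpace ℝ (Fin m)) ^ 2) ∂(surfaceMeasure m) = 0) {K : ℝ → ℝ} (hK : Continuous K) :
    ∫ x, g x * K (inner ℝ (x : EuclideanSpace ℝ (Fin m))
      (y : EuclideanSpace ℝ (Fin m)) ^ 2) ∂(surfaceMeasure m) = 0 := by
  have hc : Continuous fun x : USphere m => inner ℝ (x : EuclideanSpace ℝ (Fin m))
    (y : EuclideanSpace ℝ (Fin m)) ^ 2 := by fun_prop
  rw [← abs_eq_zero]
  refine le_antisymm (le_of_forall_pos_le_add fun ε hε => ?_) (abs_nonneg _)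
  set M := ∫ x, |g x| ∂(surfaceMeasure m) with hM
  have hM0 : 0 ≤ M := integral_nonneg fun x => abs_nonneg _
  obtain ⟨p, hp⟩ := exists_polynomial_near_of_continuousOn 0 1 K hK.continuousOn (ε / (M + 1))
    (by positivity)
  have hi1 : Integrable (fun x => g x * p.eval (inner ℝ (x : EuclideanSpace ℝ (Fin m))
      (y : EuclideanSpace ℝ (Fin m)) ^ 2)) (surfaceMeasure m) :=
    integrable_of_continuous (hg.mul (p.continuous.comp hc))
  have hi2 : Integrable (fun x => g x * K (inner ℝ (x : EuclideanSpace ℝ (Fin m))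
      (y : EuclideanSpace ℝ (Fin m)) ^ 2)) (surfaceMeasure m) :=
    integrable_of_continuous (hg.mul (hK.comp hc))
  rw [zero_add, ← abs_neg, ← zero_sub, ← h p, ← integral_sub hi1 hi2]
  calc |∫ x, (g x * p.eval (inner ℝ (x : EuclideanSpace ℝ (Fin m))
          (y : EuclideanSpace ℝ (Fin m)) ^ 2) - g x * K (inner ℝ (x : EuclideanSpace ℝ (Fin m))
          (y : EuclideanSpace ℝ (Fin m)) ^ 2)) ∂(surfaceMeasure m)|
      ≤ ∫ x, |g x| * (ε / (M + 1)) ∂(surfaceMeasure m) := by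
        have hi : Integrable (fun x => |g x| * (ε / (M + 1))) (surfaceMeasure m) :=
          (integrable_of_continuous hg.abs).mul_const _
        rw [← Real.norm_eq_abs]
        refine norm_integral_le_of_norm_le hi (.of_forall fun x => ?_)
        rw [← mul_sub, Real.norm_eq_abs, abs_mul]
        exact mul_le_mul_of_nonneg_left (hp _ (inner_sq_mem_Icc x y)).le (abs_nonneg _)
    _ = M / (M + 1) * ε := by rw [integral_mul_const, ← hM]; ring
    _ ≤ ε := mul_le_of_le_one_left hε.le ((div_le_one (by positivity)).2 (by linarith))

/-- If `g y > 0`, then the even function `g` is positive near `y` and `-y`, and its integral against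
a zonal function concentrated there is positive. -/
lemma not_pos_of_integral_mul_zonal {g : USphere m → ℝ} (hg : Continuous g)
    (heven : ∀ x, g (-x) = g x) (y : USphere m)
    (h : ∀ p : ℝ[X], ∫ x, g x * p.eval (inner ℝ (x : EuclideanSpace ℝ (Fin m))
      (y : EuclideanSpace ℝ (Fin m)) ^ 2) ∂(surfaceMeasure m) = 0) : ¬ 0 < g y := by
  intro hy
  obtain ⟨η, hη, hball⟩ := Metric.eventually_nhds_iff.1
    (hg.continuousAt.eventually (lt_mem_nhds hy))
  -- If `⟪x, y⟫ ^ 2 > 1 - δ`, then `x` or `-x` is within `√(2 δ)` of `y`.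
  obtain ⟨δ, hδ, hδ1, hδη⟩ : ∃ δ : ℝ, 0 < δ ∧ δ < 1 ∧ 2 * δ < η ^ 2 :=
    ⟨min (1 / 2) (η ^ 2 / 4), by positivity, by linarith [min_le_left (1 / 2) (η ^ 2 / 4)],
      by nlinarith [min_le_right (1 / 2) (η ^ 2 / 4), sq_pos_of_pos hη]⟩
  have hnear : ∀ x : USphere m, 1 - δ ≤ inner ℝ (x : EuclideanSpace ℝ (Fin m))
      (y : EuclideanSpace ℝ (Fin m)) → 0 < g x := by
    intro x hx
    refine hball ?_
    rw [Subtype.dist_eq, dist_eq_norm]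
    refine lt_of_pow_lt_pow_left₀ 2 hη.le ?_
    rw [norm_sub_sq_real, norm_eq_of_mem_sphere, norm_eq_of_mem_sphere]
    linarith
  have hpos : ∀ x : USphere m, 1 - δ ≤ inner ℝ (x : EuclideanSpace ℝ (Fin m))
      (y : EuclideanSpace ℝ (Fin m)) ^ 2 → 0 < g x := by
    intro x hx
    set t : ℝ := inner ℝ (x : EuclideanSpace ℝ (Fin m)) (y : EuclideanSpace ℝ (Fin m)) with ht
    have ht1 : |t| ≤ 1 := (sq_le_one_iff_abs_le_one _).1 (inner_sq_mem_Icc x y).2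
    have ht2 : 1 - δ ≤ |t| := by nlinarith [abs_nonneg t, sq_abs t]
    rcases le_total 0 t with h0 | h0
    · rw [abs_of_nonneg h0] at ht2
      exact hnear x ht2
    · rw [abs_of_nonpos h0] at ht2
      rw [← heven x]
      exact hnear (-x) (by simpa using ht2)
  let K : ℝ → ℝ := fun s => max 0 (s - (1 - δ))
  have hK : Continuous K := by fun_prop
  have hcont : Continuous fun x : USphere m => g x * K (inner ℝ (x : EuclideanSpace ℝ (Fin m))
      (y : EuclideanSpace ℝ (Fin m)) ^ 2) := hg.mul (hK.comp (by fun_prop))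
  refine (hcont.integral_pos_of_hasCompactSupport_nonneg_nonzero (μ := surfaceMeasure m)
    (HasCompactSupport.of_compactSpace _) (fun x => ?_) (x := y) ?_).ne'
    (integral_mul_zonal_continuous hg y h hK)
  · rcases le_total (1 - δ) (inner ℝ (x : EuclideanSpace ℝ (Fin m))
      (y : EuclideanSpace ℝ (Fin m)) ^ 2) with h1 | h1
    · exact mul_nonneg (hpos x h1).le (le_max_left _ _)
    · simp only [K]
      rw [max_eq_left (by linarith), mul_zero]
      exact le_rfl
  · refine mul_ne_zero hy.ne' ?_
    simp [K, hδ.ne', hδ.le]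

/-- Even zonal polynomials are total in the continuous even functions. -/
lemma eq_zero_of_integral_mul_zonal {g : USphere m → ℂ} (hg : Continuous g)
    (heven : ∀ x, g (-x) = g x)
    (h : ∀ (p : ℝ[X]) (y : USphere m), ∫ x, g x * zonal p y x ∂(surfaceMeasure m) = 0)
    (x : USphere m) : g x = 0 := by
  have hint : ∀ (p : ℝ[X]) (y : USphere m),
      Integrable (fun x => g x * zonal p y x) (surfaceMeasure m) := by
    intro p y
    refine integrable_of_continuous (hg.mul (Complex.continuous_ofReal.comp
      (p.continuous.comp ?_)))
    fun_prop
  have hre : ∀ (p : ℝ[X]) (y : USphere m), ∫ x, (g x).re *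
      p.eval (inner ℝ (x : EuclideanSpace ℝ (Fin m)) (y : EuclideanSpace ℝ (Fin m)) ^ 2)
        ∂(surfaceMeasure m) = 0 := by
    intro p y
    have := Complex.reCLM.integral_comp_comm (hint p y)
    rw [h p y, map_zero] at this
    simpa [zonal] using this
  have him : ∀ (p : ℝ[X]) (y : USphere m), ∫ x, (g x).im *
      p.eval (inner ℝ (x : EuclideanSpace ℝ (Fin m)) (y : EuclideanSpace ℝ (Fin m)) ^ 2)
        ∂(surfaceMeasure m) = 0 := by
    intro p y
    have := Complex.imCLM.integral_comp_comm (hint p y)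
    rw [h p y, map_zero] at this
    simpa [zonal] using this
  have key : ∀ k : USphere m → ℝ, Continuous k → (∀ x, k (-x) = k x) →
      (∀ (p : ℝ[X]) (y : USphere m), ∫ x, k x * p.eval (inner ℝ (x : EuclideanSpace ℝ (Fin m))
        (y : EuclideanSpace ℝ (Fin m)) ^ 2) ∂(surfaceMeasure m) = 0) → k x = 0 := by
    intro k hk hke hki
    refine le_antisymm (not_lt.1 (not_pos_of_integral_mul_zonal hk hke x fun p => hki p x)) ?_
    have := not_pos_of_integral_mul_zonal hk.neg (fun x => by simp [hke]) x fun p => by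
      simp only [Pi.neg_apply, neg_mul, integral_neg, hki, neg_zero]
    simpa using this
  exact Complex.ext
    (key _ (Complex.continuous_re.comp hg) (fun x => by simp [heven]) hre)
    (key _ (Complex.continuous_im.comp hg) (fun x => by simp [heven]) him)

end Density

/-! ### The inversion formula -/

section Operators

variable {m : ℕ}

lemma zonal_algebraMap (c : ℝ) (q : ℝ[X]) (y x : USphere m) :
    zonal (algebraMap ℝ (Module.End ℝ ℝ[X]) c q) y x = (c : ℂ) * zonal q y x := by
  simp [zonal, Module.algebraMap_end_apply]

lemma radon_even (f : USphere m → ℂ) (w : USphere m) : radon f (-w) = radon f w := by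
  rw [radon, radon, subsphereMeasure_neg]

lemma integral_comp_neg (f : USphere m → ℂ) :
    ∫ x, f (-x) ∂(surfaceMeasure m) = ∫ x, f x ∂(surfaceMeasure m) := by
  conv_rhs => rw [← surfaceMeasure_map_sphereMap (LinearIsometryEquiv.neg ℝ)]
  have he : sphereMap (LinearIsometryEquiv.neg ℝ : EuclideanSpace ℝ (Fin m) ≃ₗᵢ[ℝ] _) =
      (Homeomorph.neg (USphere m)) := by
    ext1 x
    ext1
    simp
  rw [he, (Homeomorph.neg (USphere m)).measurableEmbedding.integral_map]
  rfl

lemma sphereArea_pos {n : ℕ} (hn : 0 < n) : 0 < sphereArea n :=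
  div_pos (mul_pos two_pos (Real.rpow_pos_of_pos Real.pi_pos _))
    (Real.Gamma_pos_of_pos (by positivity))

lemma dualRadon_eq (φ : USphere m → ℂ) (x : USphere m) :
    dualRadon φ x = ((sphereArea (m - 1) : ℝ) : ℂ)⁻¹ * radon φ x := rfl

lemma integral_dualRadon_mul (φ g : USphere m → ℂ) :
    ∫ x, dualRadon φ x * g x ∂(surfaceMeasure m) =
      ((sphereArea (m - 1) : ℝ) : ℂ)⁻¹ * ∫ x, radon φ x * g x ∂(surfaceMeasure m) := by
  simp only [dualRadon_eq, mul_assoc]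
  rw [integral_const_mul]

lemma fderiv_comp_neg {E F : Type*} [NormedAddCommGroup E] [NormedSpace ℝ E]
    [NormedAddCommGroup F] [NormedSpace ℝ F] (g : E → F) (y : E) :
    fderiv ℝ (fun y => g (-y)) y = -fderiv ℝ g (-y) := by
  simpa using fderiv_comp_smul (𝕜 := ℝ) (f := g) (x := y) (-1)

variable [NeZero m]

lemma Smooth.add {f g : USphere m → ℂ} (hf : Smooth f) (hg : Smooth g) :
    Smooth fun x => f x + g x :=
  ContMDiff.add hf hg

lemma Smooth.const_mul {f : USphere m → ℂ} (hf : Smooth f) (c : ℂ) : Smooth fun x => c * f x :=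
  ((contDiff_const (c := c)).mul contDiff_id).contMDiff.comp hf

lemma Smooth.iterate_laplaceBeltrami {f : USphere m → ℂ} (hf : Smooth f) (i : ℕ) :
    Smooth (FunkTransform.laplaceBeltrami^[i] f) := by
  induction i with
  | zero => exact hf
  | succ i ih => rw [Function.iterate_succ_apply']; exact ih.laplaceBeltrami

lemma Smooth.polyLB {f : USphere m → ℂ} (hf : Smooth f) (P : ℝ[X]) :
    Smooth (FunkTransform.polyLB P f) := by
  change Smooth fun x => ∑ i ∈ P.support, (P.coeff i : ℂ) * (FunkTransform.laplaceBeltrami^[i] f) x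
  exact contMDiff_finsetSum fun i _ => (hf.iterate_laplaceBeltrami i).const_mul _

lemma Smooth.memLp {f : USphere m → ℂ} (hf : Smooth f) : MemLp f 2 (surfaceMeasure m) :=
  hf.continuous.memLp_of_hasCompactSupport (HasCompactSupport.of_compactSpace _)

/-- The Laplace-Beltrami operator preserves even functions. -/
lemma laplaceBeltrami_neg {f : USphere m → ℂ} (hf : Smooth f) (heven : ∀ x, f (-x) = f x)
    (x : USphere m) : laplaceBeltrami f (-x) = laplaceBeltrami f x := by
  rw [laplaceBeltrami_eq_laplacian hf, laplaceBeltrami_eq_laplacian hf]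
  set F := radialExt f
  have hF : ∀ y, F (-y) = F y := by
    intro y
    by_cases hy : y = 0
    · simp [hy]
    simp only [F]
    rw [radialExt_of_ne_zero f hy, radialExt_of_ne_zero f (neg_ne_zero.2 hy), ← heven]
    congr 1
    ext1
    simp
  have h1 : fderiv ℝ F = fun y => -fderiv ℝ F (-y) := by
    funext y
    conv_lhs => rw [show F = fun y => F (-y) from funext fun y => (hF y).symm]
    exact fderiv_comp_neg F y
  have h2 : ∀ y, fderiv ℝ (fderiv ℝ F) y = fderiv ℝ (fderiv ℝ F) (-y) := by
    intro y
    conv_lhs => rw [h1]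
    rw [fderiv_fun_neg, fderiv_comp_neg (fderiv ℝ F), neg_neg]
  rw [laplacian_eq_sum (stdOrthonormalBasis ℝ _), laplacian_eq_sum (stdOrthonormalBasis ℝ _)]
  refine Finset.sum_congr rfl fun i _ => ?_
  rw [h2 (x : EuclideanSpace ℝ (Fin m))]
  rfl

lemma polyLB_neg {f : USphere m → ℂ} (hf : Smooth f) (heven : ∀ x, f (-x) = f x) (P : ℝ[X])
    (x : USphere m) : polyLB P f (-x) = polyLB P f x := by
  have h : ∀ (i : ℕ) (x : USphere m), (laplaceBeltrami^[i] f) (-x) = (laplaceBeltrami^[i] f) x := by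
    intro i
    induction i with
    | zero => exact heven
    | succ i ih =>
      rw [Function.iterate_succ_apply']
      exact laplaceBeltrami_neg (hf.iterate_laplaceBeltrami i) ih
  simp only [polyLB, h]

lemma Smooth.integrable_mul {f g : USphere m → ℂ} (hf : Smooth f) (hg : Smooth g) :
    Integrable (fun x => f x * g x) (surfaceMeasure m) :=
  integrable_of_continuous (hf.continuous.mul hg.continuous)

/-- The Laplace-Beltrami operator is symmetric. -/
lemma integral_mul_laplaceBeltrami {f g : USphere m → ℂ} (hf : Smooth f) (hg : Smooth g) :
    ∫ x, laplaceBeltrami f x * g x ∂(surfaceMeasure m) =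
      ∫ x, f x * laplaceBeltrami g x ∂(surfaceMeasure m) := by
  have h := integral_sphere_mul_laplacian hf.smoothRadial hg.smoothRadial
  simp only [radialExt_coe, ← laplaceBeltrami_eq_laplacian hf, ← laplaceBeltrami_eq_laplacian hg]
    at h
  change ∫ x, (f x * laplaceBeltrami g x - g x * laplaceBeltrami f x) ∂(surfaceMeasure m) = 0 at h
  rw [integral_sub (hf.integrable_mul hg.laplaceBeltrami) (hg.integrable_mul hf.laplaceBeltrami),
    sub_eq_zero] at h
  rw [h]
  simp only [mul_comm]

lemma integral_polyLB_mul (P : ℝ[X]) {f g : USphere m → ℂ} (hf : Smooth f) (hg : Smooth g) :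
    ∫ x, polyLB P f x * g x ∂(surfaceMeasure m) = ∫ x, f x * polyLB P g x ∂(surfaceMeasure m) := by
  have hit : ∀ (i : ℕ) (f g : USphere m → ℂ), Smooth f → Smooth g →
      ∫ x, (laplaceBeltrami^[i] f) x * g x ∂(surfaceMeasure m) =
        ∫ x, f x * (laplaceBeltrami^[i] g) x ∂(surfaceMeasure m) := by
    intro i
    induction i with
    | zero => intro f g _ _; rfl
    | succ i ih =>
      intro f g hf hg
      rw [Function.iterate_succ_apply, Function.iterate_succ_apply', ih _ _ hf.laplaceBeltrami hg,
        integral_mul_laplaceBeltrami hf (hg.iterate_laplaceBeltrami i)]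
  simp only [polyLB, Polynomial.sum_def, Finset.sum_mul, Finset.mul_sum]
  rw [integral_finsetSum, integral_finsetSum]
  · refine Finset.sum_congr rfl fun i _ => ?_
    simp only [mul_assoc, mul_left_comm (f _)]
    rw [integral_const_mul, integral_const_mul, hit i f g hf hg]
  · exact fun i _ => hf.integrable_mul ((hg.iterate_laplaceBeltrami i).const_mul _)
  · exact fun i _ => ((hf.iterate_laplaceBeltrami i).const_mul _).integrable_mul hg

lemma polyLB_zonal (P q : ℝ[X]) (y : USphere m) :
    polyLB P (zonal q y) = zonal (Polynomial.aeval (zonalLaplacian m) P q) y := by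
  have h : ∀ i : ℕ, laplaceBeltrami^[i] (zonal q y) = zonal ((zonalLaplacian m ^ i) q) y := by
    intro i
    induction i with
    | zero => rfl
    | succ i ih =>
      rw [Function.iterate_succ_apply', ih, laplaceBeltrami_zonal, pow_succ', Module.End.mul_apply]
  funext x
  simp only [polyLB, h]
  rw [Polynomial.aeval_def, Polynomial.eval₂_eq_sum, Polynomial.sum_def, Polynomial.sum_def,
    LinearMap.sum_apply]
  simp only [zonal, Polynomial.eval_finsetSum, Module.End.mul_apply, Module.algebraMap_end_apply,
    Polynomial.eval_smul, smul_eq_mul, Complex.ofReal_sum, Complex.ofReal_mul]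

/-- Against zonal polynomials the inversion formula is the identity in `ℝ[X]`. -/
lemma integral_polyLB_radon_radon_mul_zonal (hm : Even m) (hm0 : 2 ≤ m) {f : USphere m → ℂ}
    (hf : Smooth f) (q : ℝ[X]) (y : USphere m) :
    ∫ x, polyLB (helgasonPoly m) (radon (radon f)) x * zonal q y x ∂(surfaceMeasure m) =
      ((helgasonConst m * sphereArea (m - 1) : ℝ) : ℂ) *
        ∫ x, f x * zonal q y x ∂(surfaceMeasure m) := by
  have hz := fun q : ℝ[X] => (smooth_zonal q y).memLp
  rw [integral_polyLB_mul _ hf.radon.radon (smooth_zonal q y), polyLB_zonal,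
    integral_radon_mul hf.radon.memLp (hz _), radon_zonal hm0, integral_radon_mul hf.memLp (hz _),
    radon_zonal hm0, ← integral_const_mul]
  have h := LinearMap.congr_fun (helgasonPoly_zonal_comm hm hm0) q
  rw [Module.End.mul_apply, Module.End.mul_apply] at h
  rw [h]
  simp only [zonal_algebraMap, mul_left_comm]

lemma integral_radon_radon_polyLB_mul_zonal (hm : Even m) (hm0 : 2 ≤ m) {f : USphere m → ℂ}
    (hf : Smooth f) (q : ℝ[X]) (y : USphere m) :
    ∫ x, radon (radon (polyLB (helgasonPoly m) f)) x * zonal q y x ∂(surfaceMeasure m) =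
      ((helgasonConst m * sphereArea (m - 1) : ℝ) : ℂ) *
        ∫ x, f x * zonal q y x ∂(surfaceMeasure m) := by
  have hz := fun q : ℝ[X] => (smooth_zonal q y).memLp
  rw [integral_radon_mul (hf.polyLB _).radon.memLp (hz _), radon_zonal hm0,
    integral_radon_mul (hf.polyLB _).memLp (hz _), radon_zonal hm0,
    integral_polyLB_mul _ hf (smooth_zonal _ y), polyLB_zonal, ← integral_const_mul]
  have h := LinearMap.congr_fun (helgasonPoly_zonal hm hm0) q
  rw [Module.End.mul_apply, Module.End.mul_apply] at h
  rw [h]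
  simp only [zonal_algebraMap, mul_left_comm]

lemma polyLB_const_mul (P : ℝ[X]) {f : USphere m → ℂ} (hf : Smooth f) (c : ℂ) (x : USphere m) :
    polyLB P (fun x => c * f x) x = c * polyLB P f x := by
  have hlap : ∀ g : USphere m → ℂ, Smooth g →
      laplaceBeltrami (fun x => c * g x) = fun x => c * laplaceBeltrami g x := by
    intro g hg
    funext x
    rw [laplaceBeltrami_eq_laplacian hg, laplaceBeltrami_eq_laplacian (hg.const_mul c)]
    have : radialExt (fun x => c * g x) = c • radialExt g := by
      funext y
      simp only [radialExt, Pi.smul_apply, smul_eq_mul]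
      split_ifs <;> simp
    rw [this]
    exact InnerProductSpace.laplacian_smul c
      ((contDiffAt_radialExt hg (ne_zero_of_mem_unit_sphere x)).of_le ENat.LEInfty.out)
  have h : ∀ i : ℕ, laplaceBeltrami^[i] (fun x => c * f x) =
      fun x => c * (laplaceBeltrami^[i] f) x := by
    intro i
    induction i with
    | zero => rfl
    | succ i ih =>
      rw [Function.iterate_succ_apply', ih, hlap _ (hf.iterate_laplaceBeltrami i),
        Function.iterate_succ_apply']
  simp only [polyLB, h, Polynomial.sum_def, Finset.mul_sum]
  exact Finset.sum_congr rfl fun i _ => by ring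

/-- The inversion formula at every point, for smooth even functions. -/
lemma polyLB_radon_radon (hm : Even m) (hm0 : 2 ≤ m) {f : USphere m → ℂ} (hf : Smooth f)
    (heven : ∀ x, f (-x) = f x) (x : USphere m) :
    polyLB (helgasonPoly m) (radon (radon f)) x =
      ((helgasonConst m * sphereArea (m - 1) : ℝ) : ℂ) * f x := by
  set c : ℂ := ((helgasonConst m * sphereArea (m - 1) : ℝ) : ℂ)
  have hsm : Smooth fun x => polyLB (helgasonPoly m) (radon (radon f)) x + -c * f x :=
    (hf.radon.radon.polyLB _).add (hf.const_mul _)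
  have h := eq_zero_of_integral_mul_zonal hsm.continuous (fun x => by
    rw [polyLB_neg hf.radon.radon (radon_even _), heven]) (fun p y => by
      simp only [add_mul, mul_assoc]
      rw [integral_add ((hf.radon.radon.polyLB _).integrable_mul (smooth_zonal p y))
        ((hf.integrable_mul (smooth_zonal p y)).const_mul _), integral_const_mul,
        integral_polyLB_radon_radon_mul_zonal hm hm0 hf]
      ring) x
  linear_combination h

/-- The inversion formula with the operators in the opposite order, for smooth functions, up to
functions that are odd. -/
lemma radon_radon_polyLB (hm : Even m) (hm0 : 2 ≤ m) {φ : USphere m → ℂ} (hφ : Smooth φ)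
    (x : USphere m) :
    2 * radon (radon (polyLB (helgasonPoly m) φ)) x =
      ((helgasonConst m * sphereArea (m - 1) : ℝ) : ℂ) * (φ x + φ (-x)) := by
  set c : ℂ := ((helgasonConst m * sphereArea (m - 1) : ℝ) : ℂ)
  have hR : Smooth (radon (radon (polyLB (helgasonPoly m) φ))) := (hφ.polyLB _).radon.radon
  have hcont : Continuous fun x => 2 * radon (radon (polyLB (helgasonPoly m) φ)) x -
      c * (φ x + φ (-x)) :=
    (continuous_const.mul hR.continuous).sub (continuous_const.mul
      (hφ.continuous.add (hφ.continuous.comp continuous_neg)))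
  have h := eq_zero_of_integral_mul_zonal hcont (fun x => by
    rw [radon_even, neg_neg, add_comm (φ (-x))]) (fun p y => by
      have hz := smooth_zonal p y
      have hi : Integrable (fun x => φ (-x) * zonal p y x) (surfaceMeasure m) :=
        integrable_of_continuous ((hφ.continuous.comp continuous_neg).mul hz.continuous)
      have hneg : ∫ x, φ (-x) * zonal p y x ∂(surfaceMeasure m) =
          ∫ x, φ x * zonal p y x ∂(surfaceMeasure m) := by
        rw [← integral_comp_neg]
        simp [zonal]
      have hs : Integrable (fun x => φ x * zonal p y x + φ (-x) * zonal p y x)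
          (surfaceMeasure m) := (hφ.integrable_mul hz).add hi
      have e : ∀ x, (2 * radon (radon (polyLB (helgasonPoly m) φ)) x - c * (φ x + φ (-x))) *
          zonal p y x = 2 * (radon (radon (polyLB (helgasonPoly m) φ)) x * zonal p y x) -
            c * (φ x * zonal p y x + φ (-x) * zonal p y x) := fun x => by ring
      simp only [e]
      rw [integral_sub ((hR.integrable_mul hz).const_mul _)
        (hs.const_mul _), integral_const_mul, integral_const_mul,
        integral_add (hφ.integrable_mul hz) hi, hneg,
        integral_radon_radon_polyLB_mul_zonal hm hm0 hφ]
      ring) x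
  linear_combination h

end Operators

end FunkTransform


theorem theorem4p1 (m : ℕ) [NeZero m] (hm : Even m) :
    (∀ f : USphere m → ℂ, MemLp f 2 (surfaceMeasure m) →
      (∀ᵐ x ∂(surfaceMeasure m), f (-x) = f x) →
        (∀ᵐ w ∂(surfaceMeasure m), Integrable f (subsphereMeasure w)) ∧
        MemLp (radon f) 2 (surfaceMeasure m) ∧
        (∀ᵐ x ∂(surfaceMeasure m), Integrable (radon f) (subsphereMeasure x)) ∧
        MemLp (dualRadon (radon f)) 2 (surfaceMeasure m) ∧
        WeakPolyLB (helgasonPoly m) (dualRadon (radon f))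
          (fun x => (helgasonConst m : ℂ) * f x)) ∧
    (∀ f : USphere m → ℂ, Smooth f → (∀ x, f (-x) = f x) →
        Smooth (radon f) ∧
        Smooth (dualRadon (radon f)) ∧
        ∀ x, (helgasonConst m : ℂ) * f x =
          polyLB (helgasonPoly m) (dualRadon (radon f)) x) := by
  have hm0 : 2 ≤ m := by
    obtain ⟨r, hr⟩ := hm
    have := NeZero.pos m
    omega
  have hσ : ((sphereArea (m - 1) : ℝ) : ℂ) ≠ 0 :=
    Complex.ofReal_ne_zero.2 (sphereArea_pos (by omega)).ne'
  refine ⟨fun f hf heven => ?_, fun f hf heven => ?_⟩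
  · have hR := memLp_radon hf
    refine ⟨ae_integrable_subsphereMeasure (hf.integrable one_le_two), hR,
      ae_integrable_subsphereMeasure (hR.integrable one_le_two),
      (memLp_radon hR).const_mul _, fun φ hφ => ?_⟩
    have hψ := hφ.polyLB (helgasonPoly m)
    rw [integral_dualRadon_mul, integral_radon_mul hR hψ.memLp,
      integral_radon_mul hf hψ.radon.memLp]
    have h1 : Integrable (fun x => f x * φ x) (surfaceMeasure m) :=
      MemLp.integrable_mul (𝕜 := ℂ) hf hφ.memLp
    have hneg : MemLp (fun x => φ (-x)) 2 (surfaceMeasure m) :=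
      (hφ.continuous.comp continuous_neg).memLp_of_hasCompactSupport
        (HasCompactSupport.of_compactSpace _)
    have h2 : Integrable (fun x => f x * φ (-x)) (surfaceMeasure m) :=
      MemLp.integrable_mul (𝕜 := ℂ) hf hneg
    have h3 : ∫ x, f x * φ (-x) ∂(surfaceMeasure m) = ∫ x, f x * φ x ∂(surfaceMeasure m) := by
      rw [← integral_comp_neg fun x => f x * φ x]
      exact integral_congr_ae (heven.mono fun x hx => by simp only [hx])
    have e : ∀ x, f x * radon (radon (polyLB (helgasonPoly m) φ)) x =
        ((helgasonConst m * sphereArea (m - 1) : ℝ) : ℂ) / 2 * (f x * φ x + f x * φ (-x)) := by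
      intro x
      linear_combination f x / 2 * radon_radon_polyLB hm hm0 hφ x
    simp only [e, mul_assoc]
    rw [integral_const_mul, integral_const_mul, integral_add h1 h2, h3]
    push_cast
    field_simp
    ring
  · refine ⟨hf.radon, hf.radon.dualRadon, fun x => ?_⟩
    change _ = polyLB (helgasonPoly m)
      (fun x => ((sphereArea (m - 1) : ℝ) : ℂ)⁻¹ * radon (radon f) x) x
    rw [polyLB_const_mul _ hf.radon.radon, polyLB_radon_radon hm hm0 hf heven]
    push_cast
    field_simp
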